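/- Let $\mathbf k$ be a field of characteristic zero. For $n\ge 2$ let $K_n$ be the Stasheff associahedron, whose vertices are the full bracketings of a word of $n$ symbols $\bullet$. For bracketings $u$ of $a$ symbols and $v$ of $b$ symbols and $1\le t\le b$, let $\iota_t(u,v)=(u,v)_t$ be the bracketing of $a+b-1$ symbols obtained by inserting $(u)$ at the $t$-th place of $v$; this also denotes the induced inclusion $\iota_t:K_a\times K_b\hookrightarrow\partial K_{a+b-1}$. Let $\prec$ be the partial order on vertices generated by the substitutions $(w_1w_2)w_3\mapsto w_1(w_2w_3)$ performed anywhere in a bracketing, and let $\xi_n$ be its minimal element. Triangulate $K_n$ inductively by $T_n$: $K_n$ is the cone with apex $\xi_n$ over the union of the $\iota_t(K_a\times K_b)$ with $a+b=n+1$, $a,b\ge2$, $2\le t\le b$, each triangulated by the product $T_a\times T_b$ of ordered simplicial complexes; the vertices of each simplex are totally ordered by $\prec$, and simplices are oriented by this order. Let $C_p(K_n)$ be the space of oriented $p$-dimensional simplicial chains of $T_n$ with coefficients in $\mathbf k$, and let $d_S:C_p(K_n)\to C_{p-1}(K_n)$ be the simplicial differential (zero for $p=0$). For $\mathbf s\in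 C_p(K_a)$ and $\mathbf t\in C_q(K_b)$ put $\mathbf s\diamond_t\mathbf t=(\iota_t)_*(\mathbf s\times\mathbf t)\in C_{p+q}(K_{a+b-1})$, where $\times$ is the simplicial (shuffle) cross product, $$\mathbf s\diamond\mathbf t=\sum_{1\le t\le b}(-1)^{(a+1)(t+q+1)}\,\mathbf s\diamond_t\mathbf t,\qquad [\mathbf s,\mathbf t]=\mathbf s\diamond\mathbf t-(-1)^{|\mathbf s||\mathbf t|}\,\mathbf t\diamond\mathbf s,$$ where $|\mathbf s|=a-p-1$ and $|\mathbf t|=b-q-1$. Then there exists a sequence of chains $\mathbf e_n\in C_n(K_{n+2})$, $n\ge0$, such that $\mathbf e_0=1\cdot(\bullet\bullet)$ and, for every $n\ge0$, $$d_S(\mathbf e_n)+\tfrac12\sum_{\substack{i,j\ge 0\\ i+j=n-1}}[\mathbf e_i,\mathbf e_j]=0 .$$ -/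

import Mathlib

namespace Associahedron

/-- Full bracketings of a word `• • ⋯ •`: the vertices of the associahedra. The vertex set of
`K_n` consists of the bracketings `u` with `u.length = n`. -/
abbrev Br : Type := FreeMagma Unit

/-- The word with a single symbol. -/
def dot : Br := FreeMagma.of ()

/-- `ins t u v` is `(u,v)_t`: the bracketing `(u)` inserted at the `t`-th place of `v`
(places are numbered from `1` to `v.length`). -/
def ins (t : ℕ) (u : Br) : Br → Br
  | FreeMagma.of _ => u
  | FreeMagma.mul v w =>
      if t ≤ v.length then ins t u v * w else v * ins (t - v.length) u w

/-- One substitution `(w₁ w₂) w₃ ↦ w₁ (w₂ w₃)`, performed anywhere inside a bracketing. -/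
inductive Step : Br → Br → Prop
  | assoc (u v w : Br) : Step ((u * v) * w) (u * (v * w))
  | left {u u' : Br} (v : Br) : Step u u' → Step (u * v) (u' * v)
  | right (u : Br) {v v' : Br} : Step v v' → Step (u * v) (u * v')

/-- The strict order `≺` on bracketings generated by the substitutions. -/
def Prec : Br → Br → Prop := Relation.TransGen Step

/-- The reflexive order `≼`. -/
def PrecEq : Br → Br → Prop := Relation.ReflTransGen Step

/-- The left comb `ξ_n = ((••)•)⋯•` with `n ≥ 1` symbols (`xi 0` is a junk value); it is the
minimal vertex of `K_n`, see `xi_precEq`. -/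
def xi : ℕ → Br
  | 0 => dot
  | 1 => dot
  | n + 2 => xi (n + 1) * dot

/-- `IsSimplex n s`: the vertices `s` span a (nonempty) simplex of the triangulation `T_n` of
`K_n`. It is the cone with apex `ξ_n` over the union of the facets `ι_t (K_a × K_b)`, where
`a + b = n + 1`, `a, b ≥ 2`, `2 ≤ t ≤ b`, each of them triangulated as the product
`T_a × T_b` of ordered simplicial complexes: a simplex of the product is a nonempty finite set of
pairs of vertices which is a chain in the product order and both of whose projections span
simplices. For `n = 2` only the apex `••` remains. -/
inductive IsSimplex : ℕ → Finset Br → Prop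
  | apex (n : ℕ) (hn : 2 ≤ n) : IsSimplex n {xi n}
  | base (a b t : ℕ) (ha : 2 ≤ a) (hb : 2 ≤ b) (ht : 2 ≤ t) (htb : t ≤ b)
      (s : Finset (Br × Br)) (hs : s.Nonempty)
      (hchain : IsChain (fun x y => PrecEq x.1 y.1 ∧ PrecEq x.2 y.2) (s : Set (Br × Br)))
      (hfst : IsSimplex a (s.image Prod.fst)) (hsnd : IsSimplex b (s.image Prod.snd)) :
      IsSimplex (a + b - 1) (s.image fun x => ins t x.1 x.2)
  | cone (a b t : ℕ) (ha : 2 ≤ a) (hb : 2 ≤ b) (ht : 2 ≤ t) (htb : t ≤ b)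
      (s : Finset (Br × Br)) (hs : s.Nonempty)
      (hchain : IsChain (fun x y => PrecEq x.1 y.1 ∧ PrecEq x.2 y.2) (s : Set (Br × Br)))
      (hfst : IsSimplex a (s.image Prod.fst)) (hsnd : IsSimplex b (s.image Prod.snd)) :
      IsSimplex (a + b - 1) (insert (xi (a + b - 1)) (s.image fun x => ins t x.1 x.2))

/-- Formal linear combinations of finite vertex sequences `[v₀, …, v_p]`. The oriented chains of
all the `K_n` are submodules of this module. -/
abbrev Chains (k : Type*) [Field k] : Type _ := List Br →₀ k

/-- `C_p(K_n)`: the `p`-dimensional oriented simplicial chains of `T_n`, free on the `p`-simplices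
`[v₀, …, v_p]`, `v₀ ≺ ⋯ ≺ v_p` (the orientation is the one given by `≺`). -/
noncomputable def C (k : Type*) [Field k] (p n : ℕ) : Submodule k (Chains k) :=
  Finsupp.supported k k
    {σ : List Br | σ.length = p + 1 ∧ σ.Pairwise Prec ∧ IsSimplex n σ.toFinset}

/-- The simplicial differential `[v₀, …, v_p] ↦ ∑ i, (-1)^i [v₀, …, v̂_i, …, v_p]`, which is zero
on `0`-simplices. -/
noncomputable def dS (k : Type*) [Field k] : Chains k →ₗ[k] Chains k :=
  Finsupp.linearCombination k fun σ : List Br =>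
    if σ.length ≤ 1 then 0
    else ∑ i ∈ Finset.range σ.length, Finsupp.single (σ.eraseIdx i) ((-1 : k) ^ i)

/-- The simplicial (Eilenberg-Zilber) cross product of two simplices
`[v₀, …, v_r] × [w₀, …, w_s]`: the sum of all `(r,s)`-shuffles, that is of the staircases from
`(v₀, w₀)` to `(v_r, w_s)` in which each step advances exactly one coordinate, with the signature
of the shuffle as coefficient. It is written as a recursion on the first step: a first step in the
`v`-direction creates no inversion, a first step in the `w`-direction is inverted with each of the
`r` steps in the `v`-direction. -/
noncomputable def cross (k : Type*) [Field k] : List Br → List Br → (List (Br × Br) →₀ k)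
  | [], _ => 0
  | _ :: _, [] => 0
  | v :: vs, w :: ws =>
      (if vs = [] ∧ ws = [] then Finsupp.single [(v, w)] 1 else 0)
        + (cross k vs (w :: ws)).mapDomain (List.cons (v, w))
        + (-1 : k) ^ vs.length • (cross k (v :: vs) ws).mapDomain (List.cons (v, w))
  termination_by σ τ => σ.length + τ.length

/-- The operation `s ⋄_t s' = (ι_t)_* (s × s')`, where `ι_t (x, y) = (x,y)_t`, extended
bilinearly. -/
noncomputable def diamondAt (k : Type*) [Field k] (t : ℕ) :
    Chains k →ₗ[k] Chains k →ₗ[k] Chains k :=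
  Finsupp.linearCombination k fun σ : List Br =>
    Finsupp.linearCombination k fun τ : List Br =>
      (cross k σ τ).mapDomain (List.map fun x => ins t x.1 x.2)

/-- The pre-Lie product
`s ⋄ s' = ∑_{1 ≤ t ≤ b} (-1)^((a+1)(t+q+1)) s ⋄_t s'` for `s ∈ C_p(K_a)`, `s' ∈ C_q(K_b)`. -/
noncomputable def diamond {k : Type*} [Field k] {p a q b : ℕ} (s : C k p a) (s' : C k q b) :
    Chains k :=
  ∑ t ∈ Finset.Icc 1 b, (-1 : k) ^ ((a + 1) * (t + q + 1)) • diamondAt k t s s'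

/-- The bracket `[s,s'] = s ⋄ s' - (-1)^(|s||s'|) s' ⋄ s` for `s ∈ C_p(K_a)`, `s' ∈ C_q(K_b)`,
where `|s| = a - p - 1` and `|s'| = b - q - 1`. -/
noncomputable def bracket {k : Type*} [Field k] {p a q b : ℕ} (s : C k p a) (s' : C k q b) :
    Chains k :=
  diamond s s' - (-1 : k) ^ (((a : ℤ) - p - 1) * ((b : ℤ) - q - 1)) • diamond s' s

theorem PrecEq.mul_left {u u' : Br} (h : PrecEq u u') (v : Br) : PrecEq (u * v) (u' * v) := by
  induction h with
  | refl => exact Relation.ReflTransGen.refl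
  | tail _ hs ih => exact ih.tail (Step.left v hs)

theorem PrecEq.mul_right (u : Br) {v v' : Br} (h : PrecEq v v') : PrecEq (u * v) (u * v') := by
  induction h with
  | refl => exact Relation.ReflTransGen.refl
  | tail _ hs ih => exact ih.tail (Step.right u hs)

theorem xi_add (m n : ℕ) : PrecEq (xi (m + 1 + (n + 1))) (xi (m + 1) * xi (n + 1)) := by
  induction n with
  | zero => exact Relation.ReflTransGen.refl
  | succ n ih =>
    have h := PrecEq.mul_left ih dot
    exact h.tail (Step.assoc _ _ _)

/-- `ξ_n` is the least bracketing of a word of length `n`. -/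
theorem xi_precEq (u : Br) : PrecEq (xi u.length) u := by
  induction u using FreeMagma.recOnMul with
  | ih1 x => exact Relation.ReflTransGen.refl
  | ih2 u v hu hv =>
    obtain ⟨m, hm⟩ := Nat.exists_eq_add_of_lt u.length_pos
    obtain ⟨n, hn⟩ := Nat.exists_eq_add_of_lt v.length_pos
    have hm' : u.length = m + 1 := by omega
    have hn' : v.length = n + 1 := by omega
    have h : (u * v).length = m + 1 + (n + 1) := by
      rw [← hm', ← hn']; rfl
    rw [h]
    rw [hm'] at hu
    rw [hn'] at hv
    exact ((xi_add m n).trans (PrecEq.mul_left hu _)).trans (PrecEq.mul_right _ hv)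

end Associahedron

/-! Each `e_i` has degree `(i + 2) - i - 1 = 1`, so `[e_i, e_j] = e_i ⋄ e_j + e_j ⋄ e_i`. Half the
sum of brackets is therefore the square `∑ e_i ⋄ e_j` over `i + j = n - 1`, and the equation to
solve is `d e_n = - square_n`. The solution is recursive: `e_n` is minus the cone over `square_n`
with apex the minimal vertex `ξ_{n+2}`.

Two facts make this work. First, `square_n` is a cycle once the equation holds below `n`
(`dS_square`). The Leibniz rule `dS_diamondAt` turns its boundary into signed triple products.
Nested insertions cancel `(x ⋄ y) ⋄ z` against part of `x ⋄ (y ⋄ z)`, by `ins_ins` and associativity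
of the cross product. Parallel insertions cancel in pairs, by `ins_comm` and graded commutativity.
Second, the cone with apex `ξ` is a contracting homotopy in positive dimensions (`dS_coneAt`), so
coning a cycle gives a primitive. Dimension zero, that is `n = 1`, is computed by hand.

The cone must also be a chain of `T_{n+2}` (`mcChain_mem`). The terms with `t ≥ 2` lie on the facets
forming the base of the triangulation. In the terms with `t = 1` every simplex already starts at the
apex, because all simplices of `e_i` and `e_j` start at theirs and `ins 1 ξ ξ = ξ`; the cone
operator kills them. Thus the facets with `t = 1` need not be shown to be subcomplexes.
Characteristic zero is used only to divide by `2`. -/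

namespace Associahedron

/-! ### Vertex sequences and their shuffle product: symmetry, associativity, Leibniz rule -/

section Generic

variable {k : Type*} [Field k] {α β γ α' β' : Type}

/-- Prepend a vertex to every vertex sequence of a chain. -/
noncomputable def pre (v : α) : (List α →₀ k) →ₗ[k] (List α →₀ k) :=
  Finsupp.lmapDomain k k (List.cons v)

/-- Push a chain forward along a map of vertices. -/
noncomputable def push (f : α → β) : (List α →₀ k) →ₗ[k] (List β →₀ k) :=
  Finsupp.lmapDomain k k (List.map f)

@[simp] theorem pre_single (v : α) (σ : List α) (c : k) :
    pre v (Finsupp.single σ c) = Finsupp.single (v :: σ) c := Finsupp.mapDomain_single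

@[simp] theorem push_single (f : α → β) (σ : List α) (c : k) :
    push f (Finsupp.single σ c) = Finsupp.single (σ.map f) c := Finsupp.mapDomain_single

theorem push_pre (f : α → β) (v : α) (x : List α →₀ k) :
    push f (pre v x) = pre (f v) (push f x) := by
  induction x using Finsupp.induction_linear with
  | zero => simp
  | add x y hx hy => simp [hx, hy]
  | single σ c => simp

theorem push_push (g : β → γ) (f : α → β) (x : List α →₀ k) :
    push g (push f x) = push (g ∘ f) x := by
  induction x using Finsupp.induction_linear with
  | zero => simp
  | add x y hx hy => simp [hx, hy]
  | single σ c => simp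

/-- The augmented boundary of a vertex sequence. -/
noncomputable def bdList : List α → (List α →₀ k)
  | [] => 0
  | v :: vs => Finsupp.single vs 1 - pre v (bdList vs)

/-- The augmented simplicial differential. -/
noncomputable def bd : (List α →₀ k) →ₗ[k] (List α →₀ k) :=
  Finsupp.linearCombination k bdList

@[simp] theorem bd_single (σ : List α) (c : k) :
    bd (Finsupp.single σ c) = c • (bdList σ : List α →₀ k) := by
  simp [bd]

theorem bd_pre (v : α) (x : List α →₀ k) : bd (pre v x) = x - pre v (bd x) := by
  induction x using Finsupp.induction_linear with
  | zero => simp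
  | add x y hx hy => simp only [map_add, hx, hy]; abel
  | single σ c => simp [bdList, smul_sub]

theorem bd_push (f : α → β) (x : List α →₀ k) : bd (push f x) = push f (bd x) := by
  induction x using Finsupp.induction_linear with
  | zero => simp
  | add x y hx hy => simp [hx, hy]
  | single σ c =>
    simp only [push_single, bd_single, map_smul]
    congr 1
    induction σ with
    | nil => simp [bdList]
    | cons v vs ih => simp [bdList, ih, push_pre]

/-- The shuffle cross product of two vertex sequences with entries in arbitrary types. -/
noncomputable def crossG : List α → List β → (List (α × β) →₀ k)
  | [], _ => 0
  | _ :: _, [] => 0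
  | v :: vs, w :: ws =>
      (if vs = [] ∧ ws = [] then Finsupp.single [(v, w)] 1 else 0)
        + pre (v, w) (crossG vs (w :: ws))
        + (-1 : k) ^ vs.length • pre (v, w) (crossG (v :: vs) ws)
  termination_by σ τ => σ.length + τ.length

@[simp] theorem crossG_nil_left (τ : List β) : (crossG ([] : List α) τ : _ →₀ k) = 0 := by
  rw [crossG]

@[simp] theorem crossG_nil_right (σ : List α) : (crossG σ ([] : List β) : _ →₀ k) = 0 := by
  cases σ <;> rw [crossG]

theorem crossG_cons_cons (v : α) (vs : List α) (w : β) (ws : List β) :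
    (crossG (v :: vs) (w :: ws) : _ →₀ k) =
      (if vs = [] ∧ ws = [] then Finsupp.single [(v, w)] 1 else 0)
        + pre (v, w) (crossG vs (w :: ws))
        + (-1 : k) ^ vs.length • pre (v, w) (crossG (v :: vs) ws) := by
  rw [crossG]

theorem cross_eq_crossG (σ τ : List Br) : cross k σ τ = crossG σ τ := by
  fun_induction cross k σ τ with
  | case1 => simp
  | case2 => simp
  | case3 v vs w ws ih1 ih2 => rw [crossG_cons_cons, ih1, ih2]; rfl

theorem crossG_map (f : α → α') (g : β → β') (σ : List α) (τ : List β) :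
    (crossG (σ.map f) (τ.map g) : _ →₀ k) = push (Prod.map f g) (crossG σ τ) := by
  fun_induction crossG (k := k) σ τ with
  | case1 => simp
  | case2 => simp
  | case3 v vs w ws ih1 ih2 =>
    simp only [List.map_cons] at ih1 ih2 ⊢
    rw [crossG_cons_cons, ih1, ih2]
    simp only [map_add, map_smul, push_pre, List.map_eq_nil_iff, List.length_map]
    split_ifs <;> simp

/-- The shuffle cross product of chains. -/
noncomputable def crossL :
    (List α →₀ k) →ₗ[k] (List β →₀ k) →ₗ[k] (List (α × β) →₀ k) :=
  Finsupp.linearCombination k fun σ => Finsupp.linearCombination k fun τ => crossG σ τ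

@[simp] theorem crossL_single (σ : List α) (τ : List β) (c d : k) :
    crossL (Finsupp.single σ c) (Finsupp.single τ d) = (c * d) • (crossG σ τ : _ →₀ k) := by
  simp [crossL, mul_smul]

/-- Two linear maps that agree on the basis elements in `S` agree on chains supported on `S`. -/
theorem eq_of_eq_on_single {M : Type*} [AddCommGroup M] [Module k M] {S : Set (List α)}
    (f g : (List α →₀ k) →ₗ[k] M)
    (h : ∀ σ ∈ S, f (Finsupp.single σ 1) = g (Finsupp.single σ 1))
    {x : List α →₀ k} (hx : x ∈ Finsupp.supported k k S) : f x = g x := by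
  rw [Finsupp.supported_eq_span_single] at hx
  refine LinearMap.eqOn_span (f := f) (g := g) ?_ hx
  rintro _ ⟨σ, hσ, rfl⟩
  exact h σ hσ

theorem hom_ext_single {M : Type*} [AddCommGroup M] [Module k M]
    (f g : (List α →₀ k) →ₗ[k] M)
    (h : ∀ σ, f (Finsupp.single σ 1) = g (Finsupp.single σ 1)) (x : List α →₀ k) :
    f x = g x :=
  eq_of_eq_on_single (S := Set.univ) f g (fun σ _ => h σ) (by simp)

theorem crossL_push (f : α → α') (g : β → β') (x : List α →₀ k) (y : List β →₀ k) :
    crossL (push f x) (push g y) = push (Prod.map f g) (crossL x y) := by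
  induction x using Finsupp.induction_linear with
  | zero => simp
  | add x y hx hy => simp [hx, hy]
  | single σ c =>
    induction y using Finsupp.induction_linear with
    | zero => simp
    | add x y hx hy => simp only [map_add, hx, hy]
    | single τ d => simp [crossG_map]

/-- Every vertex sequence in a cross product is a staircase. -/
theorem crossG_support (σ : List α) (τ : List β) :
    ∀ l ∈ (crossG σ τ : _ →₀ k).support, l.length + 1 = σ.length + τ.length ∧
      (∀ a, a ∈ l.map Prod.fst ↔ a ∈ σ) ∧ (∀ b, b ∈ l.map Prod.snd ↔ b ∈ τ) ∧
      l.head?.map Prod.fst = σ.head? ∧ l.head?.map Prod.snd = τ.head? := by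
  classical
  have hpre : ∀ (p : α × β) (x : List (α × β) →₀ k) (l), l ∈ (pre p x).support →
      ∃ m ∈ x.support, p :: m = l := by
    intro p x l hl
    simpa using Finsupp.mapDomain_support hl
  fun_induction crossG (k := k) σ τ with
  | case1 => simp
  | case2 => simp
  | case3 v vs w ws ih1 ih2 =>
    intro l hl
    rcases Finset.mem_union.1 (Finsupp.support_add hl) with hl | hl
    · rcases Finset.mem_union.1 (Finsupp.support_add hl) with hl | hl
      · by_cases h : vs = [] ∧ ws = []
        · rw [if_pos h] at hl
          have := Finsupp.support_single_subset hl
          simp only [Finset.mem_singleton] at this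
          subst this
          simp [h.1, h.2]
        · simp [h] at hl
      · obtain ⟨m, hm, rfl⟩ := hpre _ _ _ hl
        obtain ⟨h1, h2, h3, -⟩ := ih1 m hm
        refine ⟨by simp at h1 ⊢; omega, ?_, ?_, rfl, rfl⟩
        · intro a; simp only [List.map_cons, List.mem_cons, h2]
        · intro a; simp only [List.map_cons, List.mem_cons, h3]; tauto
    · obtain ⟨m, hm, rfl⟩ := hpre _ _ _ (Finsupp.support_smul hl)
      obtain ⟨h1, h2, h3, -⟩ := ih2 m hm
      refine ⟨by simp at h1 ⊢; omega, ?_, ?_, rfl, rfl⟩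
      · intro a; simp only [List.map_cons, List.mem_cons, h2]; tauto
      · intro a; simp only [List.map_cons, List.mem_cons, h3]

/-- Along a staircase both coordinates advance weakly and at least one strictly. The strict part
later gives strict `≺` after insertion, the weak part a chain in the product order. -/
theorem crossG_pairwise (R : α → α → Prop) (R' : β → β → Prop) (σ : List α) (τ : List β)
    (hσ : σ.Pairwise R) (hτ : τ.Pairwise R') :
    ∀ l ∈ (crossG σ τ : _ →₀ k).support, l.Pairwise fun x y =>
      (R x.1 y.1 ∧ (x.2 = y.2 ∨ R' x.2 y.2)) ∨ (R' x.2 y.2 ∧ (x.1 = y.1 ∨ R x.1 y.1)) := by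
  classical
  have hpre : ∀ (p : α × β) (x : List (α × β) →₀ k) (l), l ∈ (pre p x).support →
      ∃ m ∈ x.support, p :: m = l := by
    intro p x l hl
    simpa using Finsupp.mapDomain_support hl
  fun_induction crossG (k := k) σ τ with
  | case1 => simp
  | case2 => simp
  | case3 v vs w ws ih1 ih2 =>
    intro l hl
    have hσ' := List.pairwise_cons.1 hσ
    have hτ' := List.pairwise_cons.1 hτ
    rcases Finset.mem_union.1 (Finsupp.support_add hl) with hl | hl
    · rcases Finset.mem_union.1 (Finsupp.support_add hl) with hl | hl
      · by_cases h : vs = [] ∧ ws = []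
        · rw [if_pos h] at hl
          have := Finsupp.support_single_subset hl
          simp only [Finset.mem_singleton] at this
          subst this
          simp
        · simp [h] at hl
      · obtain ⟨m, hm, rfl⟩ := hpre _ _ _ hl
        obtain ⟨-, h2, h3, -⟩ := crossG_support _ _ m hm
        refine List.pairwise_cons.2 ⟨fun x hx => Or.inl ⟨hσ'.1 _ ((h2 _).1 ?_), ?_⟩,
          ih1 hσ'.2 hτ m hm⟩
        · exact List.mem_map_of_mem hx
        · rcases List.mem_cons.1 ((h3 x.2).1 (List.mem_map_of_mem hx)) with h | h
          · exact Or.inl h.symm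
          · exact Or.inr (hτ'.1 _ h)
    · obtain ⟨m, hm, rfl⟩ := hpre _ _ _ (Finsupp.support_smul hl)
      obtain ⟨-, h2, h3, -⟩ := crossG_support _ _ m hm
      refine List.pairwise_cons.2 ⟨fun x hx => Or.inr ⟨hτ'.1 _ ((h3 _).1 ?_), ?_⟩,
        ih2 hσ hτ'.2 m hm⟩
      · exact List.mem_map_of_mem hx
      · rcases List.mem_cons.1 ((h2 x.1).1 (List.mem_map_of_mem hx)) with h | h
        · exact Or.inl h.symm
        · exact Or.inr (hσ'.1 _ h)

/-- Reflecting an `(r,s)`-shuffle turns inversions into non-inversions, so signs change by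
`(-1)^(rs)`. The exponent has this parity since `r` and `s` are the lengths minus one. -/
theorem crossG_swap (σ : List α) (τ : List β) :
    (push Prod.swap (crossG σ τ) : _ →₀ k) =
      (-1 : k) ^ ((σ.length + 1) * (τ.length + 1)) • crossG τ σ := by
  fun_induction crossG (k := k) σ τ with
  | case1 => simp
  | case2 => simp
  | case3 v vs w ws ih1 ih2 =>
    simp only [map_add, map_smul, push_pre, ih1, ih2]
    rw [crossG_cons_cons w ws]
    simp only [List.length_cons, smul_add, smul_smul, Prod.swap_prod_mk]
    rw [add_right_comm]
    congr 1
    · congr 1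
      · by_cases h : vs = [] ∧ ws = []
        · simp [h.1, h.2, (by decide : Even 4).neg_one_pow]
        · rw [if_neg h, if_neg (by tauto)]
          simp
      · congr 1
        rw [← pow_add, neg_one_pow_congr]
        grind
    · congr 1
      rw [← pow_add, neg_one_pow_congr]
      grind

/-- The first-step recursion for chains: a fixed positive length makes the sign uniform and excludes
the one-point term. -/
theorem crossL_pre_left (P : α) (x : List α →₀ k) (n : ℕ) (u : β) (us : List β)
    (hx : x ∈ Finsupp.supported k k {σ : List α | σ.length = n + 1}) :
    crossL (pre P x) (Finsupp.single (u :: us) 1) =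
      pre (P, u) (crossL x (Finsupp.single (u :: us) 1)) +
      (-1 : k) ^ (n + 1) • pre (P, u) (crossL (pre P x) (Finsupp.single us 1)) := by
  refine eq_of_eq_on_single (crossL.flip (Finsupp.single (u :: us) 1) ∘ₗ pre P)
    (pre (P, u) ∘ₗ crossL.flip (Finsupp.single (u :: us) 1) +
      (-1 : k) ^ (n + 1) • (pre (P, u) ∘ₗ crossL.flip (Finsupp.single us 1) ∘ₗ pre P)) ?_ hx
  intro σ hσ
  have : σ ≠ [] := by rintro rfl; simp at hσ
  simp only [Set.mem_ofPred_eq] at hσ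
  simp [crossG_cons_cons P, this, hσ]

theorem crossL_pre_right (v : α) (vs : List α) (P : β) (y : List β →₀ k) (n : ℕ)
    (hy : y ∈ Finsupp.supported k k {σ : List β | σ.length = n + 1}) :
    crossL (Finsupp.single (v :: vs) 1) (pre P y) =
      pre (v, P) (crossL (Finsupp.single vs 1) (pre P y)) +
      (-1 : k) ^ vs.length • pre (v, P) (crossL (Finsupp.single (v :: vs) 1) y) := by
  refine eq_of_eq_on_single (crossL (Finsupp.single (v :: vs) 1) ∘ₗ pre P)
    (pre (v, P) ∘ₗ crossL (Finsupp.single vs 1) ∘ₗ pre P +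
      (-1 : k) ^ vs.length • (pre (v, P) ∘ₗ crossL (Finsupp.single (v :: vs) 1))) ?_ hy
  intro σ hσ
  have : σ ≠ [] := by rintro rfl; simp at hσ
  simp [crossG_cons_cons v, this]

theorem crossG_mem_supported (σ : List α) (τ : List β) (n : ℕ)
    (h : σ.length + τ.length = n + 1) :
    (crossG σ τ : _ →₀ k) ∈ Finsupp.supported k k {l | l.length = n} := by
  intro l hl
  have := (crossG_support σ τ l hl).1
  simp only [Set.mem_ofPred_eq]
  omega

theorem crossL_crossG_left (v : α) (vs : List α) (w : β) (ws : List β) (u : γ) (us : List γ) :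
    crossL (crossG (v :: vs) (w :: ws)) (Finsupp.single (u :: us) (1 : k)) =
      (if vs = [] ∧ ws = [] ∧ us = [] then Finsupp.single [((v, w), u)] 1 else 0)
      + pre ((v, w), u) (crossL (crossG vs (w :: ws)) (Finsupp.single (u :: us) 1))
      + (-1 : k) ^ vs.length •
          pre ((v, w), u) (crossL (crossG (v :: vs) ws) (Finsupp.single (u :: us) 1))
      + (-1 : k) ^ (vs.length + ws.length) •
          pre ((v, w), u) (crossL (crossG (v :: vs) (w :: ws)) (Finsupp.single us 1)) := by
  by_cases h : vs = [] ∧ ws = []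
  · obtain ⟨rfl, rfl⟩ := h
    simp [crossG_cons_cons]
  · have h' : ¬ (vs = [] ∧ ws = [] ∧ us = []) := by tauto
    obtain ⟨n, hn⟩ : ∃ n, vs.length + ws.length = n + 1 := by
      refine Nat.exists_eq_succ_of_ne_zero fun h0 => h ?_
      simpa using h0
    rw [crossG_cons_cons, if_neg h, if_neg h', zero_add, zero_add, ← map_smul, ← map_add]
    rw [crossL_pre_left _ _ n, hn]
    · simp
    · refine add_mem ?_ (Submodule.smul_mem _ _ ?_)
      · exact crossG_mem_supported _ _ _ (by simp; omega)
      · exact crossG_mem_supported _ _ _ (by simp; omega)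

theorem crossL_crossG_right (v : α) (vs : List α) (w : β) (ws : List β) (u : γ) (us : List γ) :
    crossL (Finsupp.single (v :: vs) (1 : k)) (crossG (w :: ws) (u :: us)) =
      (if vs = [] ∧ ws = [] ∧ us = [] then Finsupp.single [(v, w, u)] 1 else 0)
      + pre (v, w, u) (crossL (Finsupp.single vs 1) (crossG (w :: ws) (u :: us)))
      + (-1 : k) ^ vs.length •
          pre (v, w, u) (crossL (Finsupp.single (v :: vs) 1) (crossG ws (u :: us)))
      + (-1 : k) ^ (vs.length + ws.length) •
          pre (v, w, u) (crossL (Finsupp.single (v :: vs) 1) (crossG (w :: ws) us)) := by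
  by_cases h : ws = [] ∧ us = []
  · obtain ⟨rfl, rfl⟩ := h
    simp [crossG_cons_cons]
  · have h' : ¬ (vs = [] ∧ ws = [] ∧ us = []) := by tauto
    obtain ⟨n, hn⟩ : ∃ n, ws.length + us.length = n + 1 := by
      refine Nat.exists_eq_succ_of_ne_zero fun h0 => h ?_
      simpa using h0
    rw [crossG_cons_cons w, if_neg h, if_neg h', zero_add, zero_add, ← map_smul, ← map_add]
    rw [crossL_pre_right _ _ _ _ n]
    · simp [smul_smul, pow_add, add_assoc]
    · refine add_mem ?_ (Submodule.smul_mem _ _ ?_)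
      · exact crossG_mem_supported _ _ _ (by simp; omega)
      · exact crossG_mem_supported _ _ _ (by simp; omega)

/-- Both iterated products satisfy the same recursion: the first step advances one of three
coordinates, with signs `1`, `(-1)^r`, `(-1)^(r+s)`, where `r` and `s` are the dimensions of the
first two factors. -/
theorem crossG_assoc (σ : List α) (τ : List β) (ρ : List γ) :
    push (Equiv.prodAssoc α β γ) (crossL (crossG σ τ) (Finsupp.single ρ (1 : k))) =
      crossL (Finsupp.single σ 1) (crossG τ ρ) := by
  induction h : σ.length + τ.length + ρ.length using Nat.strong_induction_on
    generalizing σ τ ρ with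
  | _ n ih =>
    rcases σ with _ | ⟨v, vs⟩
    · have : (crossL (Finsupp.single ([] : List α) (1 : k)) : (List (β × γ) →₀ k) →ₗ[k] _) = 0 := by
        ext1 l
        ext1
        simp
      simp [this]
    rcases τ with _ | ⟨w, ws⟩
    · simp
    rcases ρ with _ | ⟨u, us⟩
    · have : ((crossL (k := k)).flip (Finsupp.single ([] : List γ) (1 : k)) :
          (List (α × β) →₀ k) →ₗ[k] _) = 0 := by
        ext1 l
        ext1
        simp
      have h2 := LinearMap.congr_fun this (crossG (v :: vs) (w :: ws))
      rw [LinearMap.flip_apply] at h2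
      rw [h2]
      simp
    simp only [List.length_cons] at h
    rw [crossL_crossG_left, crossL_crossG_right]
    simp only [map_add, map_smul, push_pre]
    rw [ih _ _ vs (w :: ws) (u :: us) rfl, ih _ _ (v :: vs) ws (u :: us) rfl,
      ih _ _ (v :: vs) (w :: ws) us rfl]
    · congr 3
      split_ifs <;> simp
    all_goals simp; omega

theorem crossL_assoc (x : List α →₀ k) (y : List β →₀ k) (z : List γ →₀ k) :
    push (Equiv.prodAssoc α β γ) (crossL (crossL x y) z) = crossL x (crossL y z) := by
  induction x using Finsupp.induction_linear with
  | zero => simp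
  | add x y hx hy => simp [hx, hy]
  | single σ c =>
    induction y using Finsupp.induction_linear with
    | zero => simp
    | add x y hx hy => simp [hx, hy]
    | single τ d =>
      induction z using Finsupp.induction_linear with
      | zero => simp
      | add x y hx hy => simp only [map_add, hx, hy]
      | single ρ e =>
        have h := crossG_assoc (k := k) σ τ ρ
        rw [← mul_one c, ← mul_one e, ← smul_eq_mul, ← smul_eq_mul, ← Finsupp.smul_single,
          ← Finsupp.smul_single]
        simp only [map_smul, LinearMap.smul_apply, crossL_single, smul_smul]
        simp [h, mul_comm, mul_left_comm]

theorem bdList_mem_supported (σ : List α) (n : ℕ) (h : σ.length = n + 1) :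
    (bdList σ : _ →₀ k) ∈ Finsupp.supported k k {l | l.length = n} := by
  induction σ generalizing n with
  | nil => simp at h
  | cons v vs ih =>
    simp only [List.length_cons, Nat.add_right_cancel_iff] at h
    rw [bdList]
    refine sub_mem (Finsupp.single_mem_supported _ _ h) ?_
    rcases n with _ | n
    · obtain rfl := List.length_eq_zero_iff.1 h
      simp [bdList]
    · intro l hl
      classical
      obtain ⟨m, hm, rfl⟩ : ∃ m ∈ (bdList vs : _ →₀ k).support, v :: m = l := by
        simpa using Finsupp.mapDomain_support hl
      have := ih n h hm
      simp only [Set.mem_ofPred_eq] at this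
      simp [this]

/-- The one-point term appears because the augmented boundary of a single vertex is the empty
sequence, so prepending `v` leaves the vertex `v`. -/
theorem crossL_pre_bdList_left (v : α) (vs : List α) (w : β) (ws : List β) :
    crossL (pre v (bdList vs)) (Finsupp.single (w :: ws) (1 : k)) =
      (if vs.length = 1 ∧ ws = [] then Finsupp.single [(v, w)] 1 else 0)
      + pre (v, w) (crossL (bdList vs) (Finsupp.single (w :: ws) 1))
      - (-1 : k) ^ vs.length •
          pre (v, w) (crossL (pre v (bdList vs)) (Finsupp.single ws 1)) := by
  rcases h : vs.length with _ | _ | n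
  · obtain rfl := List.length_eq_zero_iff.1 h
    simp [bdList]
  · obtain ⟨a, rfl⟩ := List.length_eq_one_iff.1 h
    simp [bdList, crossG_cons_cons]
  · rw [crossL_pre_left _ _ n _ _ (bdList_mem_supported _ _ h)]
    simp [pow_succ, sub_eq_add_neg]

theorem crossL_pre_bdList_right (v : α) (vs : List α) (w : β) (ws : List β) :
    crossL (Finsupp.single (v :: vs) (1 : k)) (pre w (bdList ws)) =
      (if vs = [] ∧ ws.length = 1 then Finsupp.single [(v, w)] 1 else 0)
      + pre (v, w) (crossL (Finsupp.single vs 1) (pre w (bdList ws)))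
      + (-1 : k) ^ vs.length •
          pre (v, w) (crossL (Finsupp.single (v :: vs) 1) (bdList ws)) := by
  rcases h : ws.length with _ | _ | n
  · obtain rfl := List.length_eq_zero_iff.1 h
    simp [bdList]
  · obtain ⟨a, rfl⟩ := List.length_eq_one_iff.1 h
    simp [bdList, crossG_cons_cons]
  · rw [crossL_pre_right _ _ _ _ n (bdList_mem_supported _ _ h)]
    simp

/-- Leibniz rule for the augmented boundary. The correction is needed for two vertices: their
product has boundary the empty sequence, while products with an empty sequence are zero. -/
theorem bd_crossG (σ : List α) (τ : List β) :
    bd (crossG σ τ : _ →₀ k) =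
      crossL (bdList σ) (Finsupp.single τ 1)
        + (-1 : k) ^ (σ.length + 1) • crossL (Finsupp.single σ 1) (bdList τ)
        + (if σ.length = 1 ∧ τ.length = 1 then Finsupp.single [] 1 else 0) := by
  fun_induction crossG (k := k) σ τ with
  | case1 τ =>
    have : (crossL (Finsupp.single ([] : List α) (1 : k)) : (List β →₀ k) →ₗ[k] _) = 0 := by
      ext1 l
      ext1
      simp
    simp [bdList, this]
  | case2 v vs =>
    have : ((crossL (k := k)).flip (Finsupp.single ([] : List β) (1 : k)) :
        (List α →₀ k) →ₗ[k] _) = 0 := by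
      ext1 l
      ext1
      simp
    have h2 := LinearMap.congr_fun this (bdList (v :: vs))
    rw [LinearMap.flip_apply] at h2
    rw [h2]
    simp [bdList]
  | case3 v vs w ws ih1 ih2 =>
    have e1 := crossL_pre_bdList_left (k := k) v vs w ws
    have e2 := crossL_pre_bdList_right (k := k) v vs w ws
    have e0 : bd (if vs = [] ∧ ws = [] then Finsupp.single [(v, w)] (1 : k) else 0)
        = if vs = [] ∧ ws = [] then Finsupp.single [] 1 else 0 := by
      split_ifs <;> simp [bdList]
    simp only [map_add, map_smul, bd_pre, ih1, ih2, e0]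
    simp only [bdList, map_sub, LinearMap.sub_apply, e1, e2, List.length_cons,
      Nat.add_eq_right, List.length_eq_zero_iff, crossL_single]
    have f1 : (pre (v, w) (if vs.length = 1 ∧ ws = [] then Finsupp.single [] (1 : k) else 0)) =
      if vs.length = 1 ∧ ws = [] then Finsupp.single [(v, w)] (1 : k) else 0 := by
      split_ifs <;> simp
    have f2 : (pre (v, w) (if vs = [] ∧ ws.length = 1 then Finsupp.single [] (1 : k) else 0)) =
      if vs = [] ∧ ws.length = 1 then Finsupp.single [(v, w)] (1 : k) else 0 := by
      split_ifs <;> simp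
    -- With the sign fixed to `1` or `-1`, what remains is a linear identity: interior faces,
    -- dropped between two steps in different directions, cancel.
    rcases neg_one_pow_eq_or k vs.length with hs | hs <;>
    · simp only [pow_succ, hs, map_smul, f1, f2]
      module

end Generic
-- Insertion of bracketings: monotonicity, minimal elements, operad identities
theorem length_mul' (u v : Br) : (u * v).length = u.length + v.length := rfl

theorem ins_of (t : ℕ) (u : Br) (x : Unit) : ins t u (FreeMagma.of x) = u := rfl

theorem ins_mul (t : ℕ) (u v w : Br) :
    ins t u (v * w) = if t ≤ v.length then ins t u v * w else v * ins (t - v.length) u w := rfl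

theorem length_ins (t : ℕ) (u v : Br) : (ins t u v).length + 1 = u.length + v.length := by
  induction v using FreeMagma.recOnMul generalizing t with
  | ih1 x => rfl
  | ih2 v w hv hw =>
    rw [ins_mul]
    split_ifs
    · have := hv t
      simp only [length_mul']
      omega
    · have := hw (t - v.length)
      simp only [length_mul']
      omega

theorem Step.length_eq {u v : Br} (h : Step u v) : u.length = v.length := by
  induction h with
  | assoc => simp only [length_mul']; omega
  | left => simp only [length_mul']; omega
  | right => simp only [length_mul']; omega

theorem Step.ins_left {u u' : Br} (h : Step u u') (t : ℕ) (v : Br) :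
    Step (ins t u v) (ins t u' v) := by
  induction v using FreeMagma.recOnMul generalizing t with
  | ih1 x => exact h
  | ih2 v w hv hw =>
    simp only [ins_mul]
    split_ifs
    · exact .left _ (hv t)
    · exact .right _ (hw _)

theorem Step.ins_right {v v' : Br} (h : Step v v') (t : ℕ) (u : Br) :
    Step (ins t u v) (ins t u v') := by
  induction h generalizing t with
  | assoc a b c =>
    have hab := length_mul' a b
    simp only [ins_mul]
    by_cases h1 : t ≤ a.length
    · rw [if_pos (by omega), if_pos h1, if_pos h1]
      exact .assoc ..
    · rw [if_neg h1, if_neg h1]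
      by_cases h2 : t ≤ (a * b).length
      · rw [if_pos h2, if_pos (by omega)]
        exact .assoc ..
      · rw [if_neg h2, if_neg (by omega), Nat.sub_sub, hab]
        exact .assoc ..
  | left v hs ih =>
    simp only [ins_mul, hs.length_eq]
    split_ifs
    · exact .left _ (ih t)
    · exact .left _ hs
  | right v hs ih =>
    simp only [ins_mul]
    split_ifs
    · exact .right _ hs
    · exact .right _ (ih _)

theorem Prec.ins_left {u u' : Br} (h : Prec u u') (t : ℕ) (v : Br) :
    Prec (ins t u v) (ins t u' v) :=
  Relation.TransGen.lift (fun u => ins t u v) (fun _ _ h => h.ins_left t v) _ _ h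

theorem Prec.ins_right {v v' : Br} (h : Prec v v') (t : ℕ) (u : Br) :
    Prec (ins t u v) (ins t u v') :=
  Relation.TransGen.lift (fun v => ins t u v) (fun _ _ h => h.ins_right t u) _ _ h

/-- A function that increases along substitutions. -/
def rank : Br → ℕ
  | FreeMagma.of _ => 0
  | FreeMagma.mul u v => rank u + rank v + v.length

theorem rank_mul (u v : Br) : rank (u * v) = rank u + rank v + v.length := rfl

theorem Step.rank_lt {u v : Br} (h : Step u v) : rank u < rank v := by
  induction h with
  | assoc u v w =>
    have := v.length_pos
    have := w.length_pos
    simp only [rank_mul, length_mul']; omega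
  | left => simp only [rank_mul]; omega
  | right v hs => have := hs.length_eq; simp only [rank_mul]; omega

theorem Prec.rank_lt {u v : Br} (h : Prec u v) : rank u < rank v := by
  induction h with
  | single h => exact h.rank_lt
  | tail _ h ih => exact ih.trans h.rank_lt

theorem Prec.ne {u v : Br} (h : Prec u v) : u ≠ v := by
  rintro rfl
  exact lt_irrefl _ h.rank_lt

theorem PrecEq.eq_or_prec {u v : Br} (h : PrecEq u v) : u = v ∨ Prec u v := by
  rcases Relation.reflTransGen_iff_eq_or_transGen.1 h with h | h
  · exact Or.inl h.symm
  · exact Or.inr h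

theorem xi_prec {n : ℕ} {u : Br} (hu : u.length = n) (hne : u ≠ xi n) : Prec (xi n) u := by
  rcases (hu ▸ xi_precEq u).eq_or_prec with h | h
  · exact absurd h.symm hne
  · exact h

/-- Minimality together with the strictly increasing `rank`, which excludes cycles of substitutions.
-/
theorem not_prec_xi {n : ℕ} {u : Br} (hu : u.length = n) : ¬ Prec u (xi n) := by
  intro h
  rcases (hu ▸ xi_precEq u : PrecEq (xi n) u).eq_or_prec with h' | h'
  · exact h.ne h'.symm
  · exact lt_asymm h.rank_lt h'.rank_lt

theorem length_xi (n : ℕ) : (xi (n + 1)).length = n + 1 := by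
  induction n with
  | zero => rfl
  | succ n ih => change (xi (n + 1) * dot).length = _; rw [length_mul', ih]; rfl

theorem ins_one_xi (m n : ℕ) : ins 1 (xi (m + 1)) (xi (n + 1)) = xi (m + n + 1) := by
  induction n with
  | zero => rfl
  | succ n ih =>
    change ins 1 (xi (m + 1)) (xi (n + 1) * dot) = xi (m + n + 1) * dot
    rw [ins_mul, if_pos (by rw [length_xi]; omega), ih]

/-- Nested insertion: place `s + 1` of `v` becomes place `t + s` of the composite once `v` occupies
places from `t` on. -/
theorem ins_ins (u v w : Br) (s t : ℕ) (hs : s < v.length) (ht : 1 ≤ t) (htw : t ≤ w.length) :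
    ins t (ins (s + 1) u v) w = ins (t + s) u (ins t v w) := by
  induction w using FreeMagma.recOnMul generalizing t with
  | ih1 x =>
    obtain rfl : t = 1 := le_antisymm htw ht
    simp only [ins_of, add_comm]
  | ih2 a b ha hb =>
    rw [length_mul'] at htw
    have := length_ins t v a
    rw [ins_mul, ins_mul]
    split_ifs with h
    · rw [ha t ht h, ins_mul, if_pos (by omega)]
    · rw [hb _ (by omega) (by omega), ins_mul, if_neg (by omega)]
      congr 2
      omega

/-- Parallel insertion: filling the earlier place `t` with `u` shifts the later place `s` by
`u.length - 1`. -/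
theorem ins_comm (u v w : Br) (s t : ℕ) (ht : 1 ≤ t) (hts : t < s) (hs : s ≤ w.length) :
    ins t u (ins s v w) = ins (s + u.length - 1) v (ins t u w) := by
  have hu := u.length_pos
  have hv := v.length_pos
  induction w using FreeMagma.recOnMul generalizing s t with
  | ih1 x =>
    change s ≤ 1 at hs
    omega
  | ih2 a b ha hb =>
    rw [length_mul'] at hs
    have := length_ins t u a
    have := length_ins s v a
    rw [ins_mul s, ins_mul t]
    by_cases h1 : s ≤ a.length
    · rw [if_pos h1, if_pos (by omega), ins_mul, ins_mul, if_pos (by omega), if_pos (by omega),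
        ha s t ht hts h1]
    · rw [if_neg h1]
      by_cases h2 : t ≤ a.length
      · rw [if_pos h2, ins_mul, ins_mul, if_pos h2, if_neg (by omega)]
        congr 2
        omega
      · rw [if_neg h2, ins_mul, ins_mul, if_neg h2, if_neg (by omega),
          hb _ _ (by omega) (by omega) (by omega)]
        congr 2
        omega

/-! ### Insertion products of chains: Leibniz, nested and parallel identities -/

section Chains

variable {k : Type*} [Field k]

/-- The chains of dimension `p` whose vertices are words of length `n`. -/
noncomputable def wordChains (k : Type*) [Field k] (p n : ℕ) : Submodule k (Chains k) :=
  Finsupp.supported k k {σ : List Br | σ.length = p + 1 ∧ ∀ v ∈ σ, v.length = n}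

theorem sum_eraseIdx (σ : List Br) :
    ∑ i ∈ Finset.range σ.length, Finsupp.single (σ.eraseIdx i) ((-1 : k) ^ i) = bdList σ := by
  induction σ with
  | nil => simp [bdList]
  | cons v vs ih =>
    rw [List.length_cons, Finset.sum_range_succ', bdList, ← ih, map_sum]
    simp only [List.eraseIdx_cons_succ, List.eraseIdx_cons_zero, pow_zero, pre_single, pow_succ,
      mul_neg, mul_one, Finsupp.single_neg, Finset.sum_neg_distrib]
    abel

theorem dS_single (σ : List Br) (c : k) :
    dS k (Finsupp.single σ c) = if σ.length ≤ 1 then 0 else c • (bdList σ : Chains k) := by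
  simp only [dS, Finsupp.linearCombination_single, sum_eraseIdx]
  split_ifs <;> simp

theorem dS_eq_bd {p n : ℕ} {x : Chains k} (hx : x ∈ wordChains k (p + 1) n) :
    dS k x = bd x := by
  refine eq_of_eq_on_single _ _ (fun σ hσ => ?_) hx
  rw [dS_single, if_neg (by rw [hσ.1]; omega), bd_single]

theorem dS_eq_zero {n : ℕ} {x : Chains k} (hx : x ∈ wordChains k 0 n) : dS k x = 0 := by
  refine eq_of_eq_on_single _ 0 (fun σ hσ => ?_) hx
  rw [dS_single, if_pos (by rw [hσ.1]), LinearMap.zero_apply]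

theorem diamondAt_eq (t : ℕ) (x y : Chains k) :
    diamondAt k t x y = push (fun x : Br × Br => ins t x.1 x.2) (crossL x y) := by
  induction x using Finsupp.induction_linear with
  | zero => simp
  | add x y hx hy => simp only [map_add, hx, hy, LinearMap.add_apply]
  | single σ c =>
    induction y using Finsupp.induction_linear with
    | zero => simp
    | add x y hx hy => simp only [map_add, hx, hy]
    | single τ d =>
      simp only [diamondAt, Finsupp.linearCombination_single, LinearMap.smul_apply, crossL_single,
        map_smul, cross_eq_crossG, mul_smul]
      rfl

theorem push_congr {α β : Type} {f g : α → β} {x : List α →₀ k} {A : Set α}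
    (hx : x ∈ Finsupp.supported k k {l | ∀ v ∈ l, v ∈ A}) (h : ∀ v ∈ A, f v = g v) :
    push f x = push g x := by
  refine eq_of_eq_on_single _ _ (fun σ hσ => ?_) hx
  rw [push_single, push_single, List.map_congr_left fun v hv => h v (hσ v hv)]

theorem crossL_mem_supported {α β : Type} {x : List α →₀ k} {y : List β →₀ k}
    {S : Set (List α)} {T : Set (List β)} {U : Set (List (α × β))}
    (hx : x ∈ Finsupp.supported k k S) (hy : y ∈ Finsupp.supported k k T)
    (h : ∀ σ ∈ S, ∀ τ ∈ T, ∀ l ∈ (crossG σ τ : List (α × β) →₀ k).support, l ∈ U) :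
    crossL x y ∈ Finsupp.supported k k U := by
  rw [Finsupp.supported_eq_span_single] at hx hy
  refine Submodule.span_induction₂
    (p := fun x y _ _ => crossL x y ∈ Finsupp.supported k k U) ?_ ?_ ?_ ?_ ?_ ?_ ?_ hx hy
  · rintro _ _ ⟨σ, hσ, rfl⟩ ⟨τ, hτ, rfl⟩
    rw [crossL_single, mul_one, one_smul]
    exact fun l hl => h σ hσ τ hτ l hl
  · intro y _; simp
  · intro x _; simp
  · intro x y z _ _ _ hx hy; rw [map_add, LinearMap.add_apply]; exact add_mem hx hy
  · intro x y z _ _ _ hx hy; rw [map_add]; exact add_mem hx hy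
  · intro r x y _ _ hx; rw [map_smul, LinearMap.smul_apply]; exact Submodule.smul_mem _ _ hx
  · intro r x y _ _ hx; rw [map_smul]; exact Submodule.smul_mem _ _ hx

theorem push_mem_supported {α β : Type} {f : α → β} {x : List α →₀ k}
    {S : Set (List α)} {T : Set (List β)} (hx : x ∈ Finsupp.supported k k S)
    (h : ∀ l ∈ S, l.map f ∈ T) : push f x ∈ Finsupp.supported k k T := by
  rw [Finsupp.supported_eq_span_single] at hx
  induction hx using Submodule.span_induction with
  | mem x hx =>
    obtain ⟨σ, hσ, rfl⟩ := hx
    rw [push_single]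
    exact Finsupp.single_mem_supported _ _ (h σ hσ)
  | zero => simp
  | add x y _ _ hx hy => rw [map_add]; exact add_mem hx hy
  | smul r x _ hx => rw [map_smul]; exact Submodule.smul_mem _ _ hx

theorem diamondAt_mem {p q a b : ℕ} (t : ℕ) {x y : Chains k} (hx : x ∈ wordChains k p a)
    (hy : y ∈ wordChains k q b) : diamondAt k t x y ∈ wordChains k (p + q) (a + b - 1) := by
  rw [diamondAt_eq]
  refine push_mem_supported (S := {l | l.length = p + q + 1 ∧
    ∀ v ∈ l, v.1.length = a ∧ v.2.length = b}) (crossL_mem_supported hx hy ?_) ?_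
  · intro σ hσ τ hτ l hl
    obtain ⟨h1, h2, h3, -⟩ := crossG_support _ _ l hl
    have h4 := hσ.1
    have h5 := hτ.1
    refine ⟨by omega, fun v hv => ⟨hσ.2 _ ((h2 _).1 (List.mem_map_of_mem hv)),
      hτ.2 _ ((h3 _).1 (List.mem_map_of_mem hv))⟩⟩
  · rintro l ⟨h1, h2⟩
    refine ⟨by rw [List.length_map, h1], ?_⟩
    intro v hv
    obtain ⟨w, hw, rfl⟩ := List.mem_map.1 hv
    have := length_ins t w.1 w.2
    obtain ⟨h3, h4⟩ := h2 w hw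
    omega

/-- The correction in `bd_crossG` disappears here, since the unaugmented differential vanishes on
vertices. -/
theorem dS_diamondAt {p a : ℕ} (t : ℕ) {x : Chains k} (hx : x ∈ wordChains k p a)
    (y : Chains k) :
    dS k (diamondAt k t x y) =
      diamondAt k t (dS k x) y + (-1 : k) ^ p • diamondAt k t x (dS k y) := by
  have key : ∀ σ τ : List Br, dS k (diamondAt k t (Finsupp.single σ 1) (Finsupp.single τ 1)) =
      diamondAt k t (dS k (Finsupp.single σ 1)) (Finsupp.single τ 1) +
      (-1 : k) ^ (σ.length + 1) •
        diamondAt k t (Finsupp.single σ 1) (dS k (Finsupp.single τ 1)) := by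
    intro σ τ
    by_cases h0 : σ.length = 0 ∨ τ.length = 0
    · rcases h0 with h0 | h0
      · obtain rfl := List.length_eq_zero_iff.1 h0
        have : (crossL (Finsupp.single ([] : List Br) (1 : k)) :
            (List Br →₀ k) →ₗ[k] (List (Br × Br) →₀ k)) = 0 := by
          ext1 l
          ext1
          simp
        simp [diamondAt_eq, dS_single, this]
      · obtain rfl := List.length_eq_zero_iff.1 h0
        have : ((crossL (k := k)).flip (Finsupp.single ([] : List Br) (1 : k)) :
            (List Br →₀ k) →ₗ[k] (List (Br × Br) →₀ k)) = 0 := by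
          ext1 l
          ext1
          simp
        have h2 := LinearMap.congr_fun this (dS k (Finsupp.single σ 1))
        rw [LinearMap.flip_apply] at h2
        simp only [diamondAt_eq, h2]
        simp [dS_single]
    -- Inside a product the two differentials agree: they differ only by multiples of the empty
    -- sequence, whose products vanish.
    have e1 : diamondAt k t (dS k (Finsupp.single σ 1)) (Finsupp.single τ 1) =
        push (fun x : Br × Br => ins t x.1 x.2) (crossL (bdList σ) (Finsupp.single τ 1)) := by
      rw [diamondAt_eq, dS_single]
      split_ifs with h
      · obtain ⟨v, rfl⟩ := List.length_eq_one_iff.1 (show σ.length = 1 by omega)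
        simp [bdList]
      · rw [one_smul]
    have e2 : diamondAt k t (Finsupp.single σ 1) (dS k (Finsupp.single τ 1)) =
        push (fun x : Br × Br => ins t x.1 x.2) (crossL (Finsupp.single σ 1) (bdList τ)) := by
      rw [diamondAt_eq, dS_single]
      split_ifs with h
      · obtain ⟨v, rfl⟩ := List.length_eq_one_iff.1 (show τ.length = 1 by omega)
        simp [bdList]
      · rw [one_smul]
    rw [e1, e2]
    by_cases h1 : σ.length = 1 ∧ τ.length = 1
    · obtain ⟨v, rfl⟩ := List.length_eq_one_iff.1 h1.1
      obtain ⟨w, rfl⟩ := List.length_eq_one_iff.1 h1.2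
      simp [diamondAt_eq, crossG_cons_cons, dS_single, bdList]
    · have hm : diamondAt k t (Finsupp.single σ 1) (Finsupp.single τ 1) ∈
          Finsupp.supported k k {l : List Br | l.length ≠ 1} := by
        rw [diamondAt_eq, crossL_single, mul_one, one_smul]
        refine push_mem_supported (crossG_mem_supported σ τ (σ.length + τ.length - 1)
          (by omega)) ?_
        intro l hl
        simp only [Set.mem_ofPred_eq] at hl
        simp only [ne_eq, Set.mem_ofPred_eq, List.length_map, hl]
        omega
      have hd : dS k (diamondAt k t (Finsupp.single σ 1) (Finsupp.single τ 1)) =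
          bd (diamondAt k t (Finsupp.single σ 1) (Finsupp.single τ 1)) := by
        refine eq_of_eq_on_single _ _ (fun l hl => ?_) hm
        rw [dS_single, bd_single]
        split_ifs with h
        · rw [List.length_eq_zero_iff.1 (show l.length = 0 by
            simp only [ne_eq, Set.mem_ofPred_eq] at hl; omega)]
          simp [bdList]
        · rfl
      rw [hd, diamondAt_eq, bd_push, crossL_single, mul_one, one_smul, bd_crossG, if_neg h1]
      simp
  refine eq_of_eq_on_single (dS k ∘ₗ (diamondAt k t).flip y)
    ((diamondAt k t).flip y ∘ₗ dS k + (-1 : k) ^ p • (diamondAt k t).flip (dS k y))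
    (fun σ hσ => ?_) hx
  refine hom_ext_single (dS k ∘ₗ diamondAt k t (Finsupp.single σ 1))
    (diamondAt k t (dS k (Finsupp.single σ 1)) +
      (-1 : k) ^ p • diamondAt k t (Finsupp.single σ 1) ∘ₗ dS k) (fun τ => ?_) y
  have := key σ τ
  rw [hσ.1, pow_succ, pow_succ, mul_assoc, neg_one_mul, neg_neg, mul_one] at this
  exact this

theorem diamondAt_assoc {p q r a b c : ℕ} (s t : ℕ) (hs : s < b) (ht : 1 ≤ t) (htc : t ≤ c)
    {x y z : Chains k} (hx : x ∈ wordChains k p a) (hy : y ∈ wordChains k q b)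
    (hz : z ∈ wordChains k r c) :
    diamondAt k t (diamondAt k (s + 1) x y) z =
      diamondAt k (t + s) x (diamondAt k t y z) := by
  have e1 : diamondAt k t (diamondAt k (s + 1) x y) z =
      push (fun v : Br × Br × Br => ins t (ins (s + 1) v.1 v.2.1) v.2.2)
        (crossL x (crossL y z)) := by
    rw [diamondAt_eq, diamondAt_eq]
    -- Writing `z` as a pushforward along the identity makes naturality of the cross product
    -- applicable to both factors at once.
    nth_rewrite 1 [← show push id z = z by simp [push, Finsupp.lmapDomain]]
    rw [crossL_push, push_push, ← crossL_assoc, push_push]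
    rfl
  have e2 : diamondAt k (t + s) x (diamondAt k t y z) =
      push (fun v : Br × Br × Br => ins (t + s) v.1 (ins t v.2.1 v.2.2))
        (crossL x (crossL y z)) := by
    rw [diamondAt_eq, diamondAt_eq]
    nth_rewrite 1 [← show push id x = x by simp [push, Finsupp.lmapDomain]]
    rw [crossL_push, push_push]
    rfl
  rw [e1, e2]
  refine push_congr (A := {v | v.2.1.length = b ∧ v.2.2.length = c})
    (crossL_mem_supported hx (crossL_mem_supported (U := {l | ∀ v ∈ l, v.1.length = b ∧
      v.2.length = c}) hy hz ?_) ?_) ?_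
  · intro σ hσ τ hτ l hl v hv
    obtain ⟨-, h2, h3, -⟩ := crossG_support _ _ l hl
    exact ⟨hσ.2 _ ((h2 _).1 (List.mem_map_of_mem hv)), hτ.2 _ ((h3 _).1 (List.mem_map_of_mem hv))⟩
  · intro σ hσ τ hτ l hl v hv
    obtain ⟨-, h2, h3, -⟩ := crossG_support _ _ l hl
    exact hτ _ ((h3 _).1 (List.mem_map_of_mem hv))
  · rintro v ⟨h1, h2⟩
    exact ins_ins _ _ _ _ _ (by omega) ht (by omega)

theorem crossL_swap {p q a b : ℕ} {x y : Chains k} (hx : x ∈ wordChains k p a)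
    (hy : y ∈ wordChains k q b) :
    push Prod.swap (crossL x y) = (-1 : k) ^ (p * q) • crossL y x := by
  refine eq_of_eq_on_single (push Prod.swap ∘ₗ crossL.flip y)
    ((-1 : k) ^ (p * q) • crossL y) (fun σ hσ => ?_) hx
  refine eq_of_eq_on_single (push Prod.swap ∘ₗ crossL (Finsupp.single σ 1))
    ((-1 : k) ^ (p * q) • crossL.flip (Finsupp.single σ 1)) (fun τ hτ => ?_) hy
  simp only [LinearMap.comp_apply, LinearMap.smul_apply, LinearMap.flip_apply, crossL_single,
    mul_one, one_smul, crossG_swap, hσ.1, hτ.1]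
  congr 1
  rw [neg_one_pow_congr]
  grind

/-- The vertices agree by `ins_comm`; the sign is the Koszul sign of exchanging `x` and `y` in the
cross product. -/
theorem diamondAt_comm {p q r a b c : ℕ} (s t : ℕ) (ht : 1 ≤ t) (hts : t < s) (hsc : s ≤ c)
    {x y z : Chains k} (hx : x ∈ wordChains k p a) (hy : y ∈ wordChains k q b)
    (hz : z ∈ wordChains k r c) :
    diamondAt k t x (diamondAt k s y z) =
      (-1 : k) ^ (p * q) • diamondAt k (s + a - 1) y (diamondAt k t x z) := by
  have e1 : diamondAt k t x (diamondAt k s y z) =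
      push (fun v : Br × Br × Br => ins t v.1 (ins s v.2.1 v.2.2))
        (crossL x (crossL y z)) := by
    rw [diamondAt_eq, diamondAt_eq]
    nth_rewrite 1 [← show push id x = x by simp [push, Finsupp.lmapDomain]]
    rw [crossL_push, push_push]
    rfl
  have e2 : (-1 : k) ^ (p * q) • diamondAt k (s + a - 1) y (diamondAt k t x z) =
      push (fun v : Br × Br × Br => ins (s + a - 1) v.2.1 (ins t v.1 v.2.2))
        (crossL x (crossL y z)) := by
    rw [diamondAt_eq, diamondAt_eq]
    nth_rewrite 1 [← show push id y = y by simp [push, Finsupp.lmapDomain]]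
    rw [crossL_push, push_push, ← crossL_assoc, push_push, ← map_smul, ← LinearMap.smul_apply,
      ← map_smul, ← crossL_swap hx hy]
    nth_rewrite 1 [← show push id z = z by simp [push, Finsupp.lmapDomain]]
    rw [crossL_push, push_push, ← crossL_assoc, push_push]
    rfl
  rw [e1, e2]
  refine push_congr (A := {v | v.1.length = a ∧ v.2.2.length = c})
    (crossL_mem_supported hx (crossL_mem_supported (U := {l | ∀ v ∈ l,
      v.2.length = c}) hy hz ?_) ?_) ?_
  · intro σ hσ τ hτ l hl v hv
    obtain ⟨-, h2, h3, -⟩ := crossG_support _ _ l hl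
    exact hτ.2 _ ((h3 _).1 (List.mem_map_of_mem hv))
  · intro σ hσ τ hτ l hl v hv
    obtain ⟨-, h2, h3, -⟩ := crossG_support _ _ l hl
    exact ⟨hσ.2 _ ((h2 _).1 (List.mem_map_of_mem hv)), hτ _ ((h3 _).1 (List.mem_map_of_mem hv))⟩
  · rintro v ⟨h1, h2⟩
    rw [ins_comm _ _ _ _ _ ht hts (by omega), h1]

end Chains
-- Reindexing of sums over compositions
section Pairs

/-- The pairs `(i, j)` with `i + j + 1 = n`. -/
def pairs (n : ℕ) : Finset (ℕ × ℕ) :=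
  (Finset.range n ×ˢ Finset.range n).filter fun ij => ij.1 + ij.2 + 1 = n

/-- The triples `(i, j, l)` with `i + j + l + 2 = n`. -/
def triples (n : ℕ) : Finset (ℕ × ℕ × ℕ) :=
  (Finset.range n ×ˢ Finset.range n ×ˢ Finset.range n).filter
    fun x => x.1 + x.2.1 + x.2.2 + 2 = n

theorem mem_pairs {n : ℕ} {x : ℕ × ℕ} : x ∈ pairs n ↔ x.1 + x.2 + 1 = n := by
  simp only [pairs, Finset.mem_filter, Finset.mem_product, Finset.mem_range]
  omega

theorem mem_triples {n : ℕ} {x : ℕ × ℕ × ℕ} :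
    x ∈ triples n ↔ x.1 + x.2.1 + x.2.2 + 2 = n := by
  simp only [triples, Finset.mem_filter, Finset.mem_product, Finset.mem_range]
  omega

variable {M : Type*} [AddCommMonoid M]

theorem sum_pairs_left (n : ℕ) (F : ℕ → ℕ → ℕ → M) :
    ∑ x ∈ pairs n, ∑ y ∈ pairs x.1, F y.1 y.2 x.2 = ∑ z ∈ triples n, F z.1 z.2.1 z.2.2 := by
  rw [Finset.sum_sigma']
  refine Finset.sum_nbij' (fun x => (x.2.1, x.2.2, x.1.2))
    (fun z => ⟨(z.1 + z.2.1 + 1, z.2.2), (z.1, z.2.1)⟩) ?_ ?_ ?_ ?_ ?_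
  · rintro ⟨⟨a, b⟩, c, d⟩ h
    simp only [Finset.mem_sigma, mem_pairs, mem_triples] at h ⊢
    omega
  · rintro ⟨a, b, c⟩ h
    rw [mem_triples] at h
    refine Finset.mem_sigma.2 ⟨mem_pairs.2 ?_, mem_pairs.2 rfl⟩
    rw [← h]
    ring
  · rintro ⟨⟨a, b⟩, c, d⟩ h
    simp only [Finset.mem_sigma, mem_pairs] at h
    obtain ⟨-, rfl⟩ := h
    rfl
  · rintro ⟨a, b, c⟩ h
    rfl
  · rintro ⟨⟨a, b⟩, c, d⟩ h
    rfl

theorem sum_pairs_right (n : ℕ) (F : ℕ → ℕ → ℕ → M) :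
    ∑ x ∈ pairs n, ∑ y ∈ pairs x.2, F x.1 y.1 y.2 = ∑ z ∈ triples n, F z.1 z.2.1 z.2.2 := by
  rw [Finset.sum_sigma']
  refine Finset.sum_nbij' (fun x => (x.1.1, x.2.1, x.2.2))
    (fun z => ⟨(z.1, z.2.1 + z.2.2 + 1), (z.2.1, z.2.2)⟩) ?_ ?_ ?_ ?_ ?_
  · rintro ⟨⟨a, b⟩, c, d⟩ h
    simp only [Finset.mem_sigma, mem_pairs, mem_triples] at h ⊢
    omega
  · rintro ⟨a, b, c⟩ h
    rw [mem_triples] at h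
    refine Finset.mem_sigma.2 ⟨mem_pairs.2 ?_, mem_pairs.2 rfl⟩
    rw [← h]
    ring
  · rintro ⟨⟨a, b⟩, c, d⟩ h
    simp only [Finset.mem_sigma, mem_pairs] at h
    obtain ⟨-, rfl⟩ := h
    rfl
  · rintro ⟨a, b, c⟩ h
    rfl
  · rintro ⟨⟨a, b⟩, c, d⟩ h
    rfl

theorem sum_triples_swap (n : ℕ) (F : ℕ → ℕ → ℕ → M) :
    ∑ z ∈ triples n, F z.1 z.2.1 z.2.2 = ∑ z ∈ triples n, F z.2.1 z.1 z.2.2 := by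
  refine Finset.sum_nbij' (fun z => (z.2.1, z.1, z.2.2)) (fun z => (z.2.1, z.1, z.2.2))
    ?_ ?_ (fun _ _ => rfl) (fun _ _ => rfl) (fun _ _ => rfl) <;>
  · intro z h
    simp only [mem_triples] at h ⊢
    omega

theorem Icc_one_eq_Ico (n : ℕ) : Finset.Icc 1 n = Finset.Ico 1 (n + 1) := by
  ext; simp only [Finset.mem_Icc, Finset.mem_Ico]; omega

end Pairs

/-! ### The pre-Lie cancellation: the square is a cycle -/

section SquareZero

variable {k : Type*} [Field k]

/-- The pre-Lie product `e_i ⋄ e_j` of chains `e_i ∈ C_i(K_{i+2})`. -/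
noncomputable def preLie (i j : ℕ) (x y : Chains k) : Chains k :=
  ∑ t ∈ Finset.Icc 1 (j + 2), (-1 : k) ^ ((i + 3) * (t + j + 1)) • diamondAt k t x y

/-- The sum of the products `e_i ⋄ e_j` with `i + j = n - 1`. -/
noncomputable def square (e : ℕ → Chains k) (n : ℕ) : Chains k :=
  ∑ x ∈ pairs n, preLie x.1 x.2 (e x.1) (e x.2)

variable (e : ℕ → Chains k)

/-- The summands of the product of a product with a chain. -/
noncomputable def leftTerm (i j l t s : ℕ) : Chains k :=
  (-1 : k) ^ ((i + j + 4) * (t + l + 1) + (i + 3) * (s + j + 1)) •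
    diamondAt k t (diamondAt k s (e i) (e j)) (e l)

/-- The summands of the signed product of a chain with a product. -/
noncomputable def rightTerm (i j l t s : ℕ) : Chains k :=
  (-1 : k) ^ (i + (i + 3) * (t + (j + l + 1) + 1) + (j + 3) * (s + l + 1)) •
    diamondAt k t (e i) (diamondAt k s (e j) (e l))

variable {e}

theorem neg_neg_one_pow (n : ℕ) : -(-1 : k) ^ n = (-1) ^ (n + 1) := by
  rw [pow_succ, mul_neg_one]

/-- In `rightTerm` the leading `i` is the Leibniz sign, and `j + l + 1` is the dimension of the
chain that was differentiated, not of the product replacing its boundary. This shift makes the two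
signs opposite. -/
theorem rightTerm_nested {i j l : ℕ} (hi : e i ∈ wordChains k i (i + 2))
    (hj : e j ∈ wordChains k j (j + 2)) (hl : e l ∈ wordChains k l (l + 2)) {t s : ℕ}
    (hs : s < j + 2) (ht : 1 ≤ t) (htl : t ≤ l + 2) :
    rightTerm e i j l (t + s) t = - leftTerm e i j l t (s + 1) := by
  rw [rightTerm, leftTerm, diamondAt_assoc s t hs ht htl hi hj hl, ← neg_smul]
  congr 1
  rw [neg_neg_one_pow, neg_one_pow_congr]
  grind

theorem rightTerm_parallel {i j l : ℕ} (hi : e i ∈ wordChains k i (i + 2))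
    (hj : e j ∈ wordChains k j (j + 2)) (hl : e l ∈ wordChains k l (l + 2)) {t s : ℕ}
    (ht : 1 ≤ t) (hts : t < s) (hsl : s ≤ l + 2) :
    rightTerm e i j l t s = - rightTerm e j i l (s + (i + 1)) t := by
  rw [rightTerm, rightTerm, diamondAt_comm s t ht hts hsl hi hj hl, ← neg_smul, smul_smul]
  congr 1
  rw [neg_neg_one_pow, ← pow_add,
    -- The two exponents, Koszul sign `i * j` included, differ by the even number `4 (i + 1)`.
    show j + (j + 3) * (s + (i + 1) + (i + l + 1) + 1) + (i + 3) * (t + l + 1) + 1 =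
      i + (i + 3) * (t + (j + l + 1) + 1) + (j + 3) * (s + l + 1) + i * j + 2 * (2 * (i + 1)) by
        ring, pow_add _ _ (2 * _), (even_two_mul _).neg_one_pow, mul_one]

/-- With `e_j` at place `s` of `e_l`, the place `t` for `e_i` lies before `e_j` (`t < s`), inside it
(`s ≤ t < s + j + 2`) or after it. The inside terms are nested insertions; those after are reindexed
by the original place in `e_l`. -/
theorem sum_rightTerm {i j l : ℕ} (hi : e i ∈ wordChains k i (i + 2))
    (hj : e j ∈ wordChains k j (j + 2)) (hl : e l ∈ wordChains k l (l + 2)) :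
    ∑ t ∈ Finset.Icc 1 (j + l + 3), ∑ s ∈ Finset.Icc 1 (l + 2), rightTerm e i j l t s =
      ∑ s ∈ Finset.Ico 1 (l + 3), ∑ t ∈ Finset.Ico 1 s, rightTerm e i j l t s
      - ∑ t ∈ Finset.Icc 1 (l + 2), ∑ s ∈ Finset.Icc 1 (j + 2), leftTerm e i j l t s
      + ∑ s ∈ Finset.Ico 1 (l + 3), ∑ t ∈ Finset.Ico (s + 1) (l + 3),
          rightTerm e i j l (t + (j + 1)) s := by
  rw [Finset.sum_comm]
  simp only [Icc_one_eq_Ico]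
  rw [← Finset.sum_sub_distrib, ← Finset.sum_add_distrib]
  refine Finset.sum_congr rfl fun s hs => ?_
  rw [Finset.mem_Ico] at hs
  rw [← Finset.sum_Ico_consecutive _ hs.1 (show s ≤ j + l + 3 + 1 by omega),
    ← Finset.sum_Ico_consecutive _ (show s ≤ s + (j + 2) by omega)
      (show s + (j + 2) ≤ j + l + 3 + 1 by omega), ← add_assoc]
  congr 1
  · rw [sub_eq_add_neg]
    congr 1
    rw [Finset.sum_Ico_eq_sum_range, Finset.sum_Ico_eq_sum_range, ← Finset.sum_neg_distrib]
    refine Finset.sum_congr (by congr 1; omega) fun t ht => ?_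
    rw [Finset.mem_range] at ht
    rw [rightTerm_nested hi hj hl (by omega) hs.1 (by omega), add_comm t 1]
  · rw [Finset.sum_Ico_add' (fun t => rightTerm e i j l t s)]
    refine Finset.sum_congr ?_ fun _ _ => rfl
    congr 1 <;> omega

theorem sum_rightTerm_parallel {i j l : ℕ} (hi : e i ∈ wordChains k i (i + 2))
    (hj : e j ∈ wordChains k j (j + 2)) (hl : e l ∈ wordChains k l (l + 2)) :
    ∑ s ∈ Finset.Ico 1 (l + 3), ∑ t ∈ Finset.Ico 1 s, rightTerm e i j l t s
      + ∑ s ∈ Finset.Ico 1 (l + 3), ∑ t ∈ Finset.Ico (s + 1) (l + 3),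
          rightTerm e j i l (t + (i + 1)) s = 0 := by
  -- Exchanging summation in the second sum puts both over the same pairs `t < s`, where they cancel
  -- termwise.
  rw [Finset.sum_Ico_Ico_comm', ← Finset.sum_add_distrib]
  refine Finset.sum_eq_zero fun s hs => ?_
  rw [← Finset.sum_add_distrib]
  refine Finset.sum_eq_zero fun t ht => ?_
  rw [Finset.mem_Ico] at hs ht
  rw [rightTerm_parallel hi hj hl ht.1 ht.2 (by omega), neg_add_cancel]

theorem sum_terms_eq_zero {n : ℕ} (he : ∀ i < n, e i ∈ wordChains k i (i + 2)) :
    ∑ z ∈ triples n, ((∑ t ∈ Finset.Icc 1 (z.2.2 + 2), ∑ s ∈ Finset.Icc 1 (z.2.1 + 2),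
        leftTerm e z.1 z.2.1 z.2.2 t s) +
      ∑ t ∈ Finset.Icc 1 (z.2.1 + z.2.2 + 3), ∑ s ∈ Finset.Icc 1 (z.2.2 + 2),
        rightTerm e z.1 z.2.1 z.2.2 t s) = 0 := by
  have h : ∀ z ∈ triples n, z.1 < n ∧ z.2.1 < n ∧ z.2.2 < n := by
    intro z hz
    rw [mem_triples] at hz
    omega
  -- The nested terms cancel within each triple. The remaining terms cancel only after exchanging
  -- `i` and `j` in the second sum.
  rw [Finset.sum_congr rfl fun z hz => by
    rw [sum_rightTerm (he _ (h z hz).1) (he _ (h z hz).2.1) (he _ (h z hz).2.2), add_comm,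
      sub_add_eq_add_sub, sub_add_cancel]]
  rw [Finset.sum_add_distrib, sum_triples_swap n fun i j l =>
    ∑ s ∈ Finset.Ico 1 (l + 3), ∑ t ∈ Finset.Ico (s + 1) (l + 3),
      rightTerm e i j l (t + (j + 1)) s, ← Finset.sum_add_distrib]
  exact Finset.sum_eq_zero fun z hz =>
    sum_rightTerm_parallel (he _ (h z hz).1) (he _ (h z hz).2.1) (he _ (h z hz).2.2)

/-- If every earlier chain satisfies the Maurer–Cartan equation, the next square is a cycle. -/
theorem dS_square {n : ℕ} (he : ∀ i < n, e i ∈ wordChains k i (i + 2))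
    (hd : ∀ i < n, dS k (e i) = - square e i) : dS k (square e n) = 0 := by
  have key : dS k (square e n) = - ((∑ x ∈ pairs n, ∑ y ∈ pairs x.1,
      ∑ t ∈ Finset.Icc 1 (x.2 + 2), ∑ s ∈ Finset.Icc 1 (y.2 + 2), leftTerm e y.1 y.2 x.2 t s) +
      ∑ x ∈ pairs n, ∑ y ∈ pairs x.2, ∑ t ∈ Finset.Icc 1 (y.1 + y.2 + 3),
        ∑ s ∈ Finset.Icc 1 (y.2 + 2), rightTerm e x.1 y.1 y.2 t s) := by
    rw [← Finset.sum_add_distrib, ← Finset.sum_neg_distrib, square, map_sum]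
    refine Finset.sum_congr rfl fun x hx => ?_
    rw [mem_pairs] at hx
    have h1 : ∑ y ∈ pairs x.1, ∑ t ∈ Finset.Icc 1 (x.2 + 2), ∑ s ∈ Finset.Icc 1 (y.2 + 2),
        leftTerm e y.1 y.2 x.2 t s = ∑ t ∈ Finset.Icc 1 (x.2 + 2),
          (-1 : k) ^ ((x.1 + 3) * (t + x.2 + 1)) • diamondAt k t (square e x.1) (e x.2) := by
      rw [Finset.sum_comm]
      refine Finset.sum_congr rfl fun t _ => ?_
      simp only [square, preLie, map_sum, LinearMap.sum_apply, Finset.smul_sum, map_smul,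
        LinearMap.smul_apply, smul_smul, ← pow_add, leftTerm]
      refine Finset.sum_congr rfl fun y hy => ?_
      rw [← mem_pairs.1 hy]
    have h2 : ∑ y ∈ pairs x.2, ∑ t ∈ Finset.Icc 1 (y.1 + y.2 + 3),
        ∑ s ∈ Finset.Icc 1 (y.2 + 2), rightTerm e x.1 y.1 y.2 t s =
          ∑ t ∈ Finset.Icc 1 (x.2 + 2), (-1 : k) ^ (x.1 + (x.1 + 3) * (t + x.2 + 1)) •
            diamondAt k t (e x.1) (square e x.2) := by
      simp only [square, preLie, map_sum, Finset.smul_sum, map_smul, smul_smul,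
        ← pow_add, rightTerm]
      rw [Finset.sum_comm]
      refine Finset.sum_congr rfl fun y hy => ?_
      rw [← mem_pairs.1 hy]
    rw [h1, h2, ← Finset.sum_add_distrib, ← Finset.sum_neg_distrib, preLie, map_sum]
    refine Finset.sum_congr rfl fun t _ => ?_
    -- Leibniz and the equations below `n` replace each boundary by a square; the outer coefficient
    -- keeps its original exponent.
    rw [map_smul, dS_diamondAt t (he _ (by omega)), hd _ (by omega), hd _ (by omega)]
    simp only [map_neg, LinearMap.neg_apply, pow_add]
    module
  rw [key, neg_eq_zero, sum_pairs_left n fun i j l => ∑ t ∈ Finset.Icc 1 (l + 2),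
      ∑ s ∈ Finset.Icc 1 (j + 2), leftTerm e i j l t s,
    sum_pairs_right n fun i j l => ∑ t ∈ Finset.Icc 1 (j + l + 3),
      ∑ s ∈ Finset.Icc 1 (l + 2), rightTerm e i j l t s, ← Finset.sum_add_distrib]
  exact sum_terms_eq_zero he

end SquareZero

theorem IsSimplex.length_eq {n : ℕ} {s : Finset Br} (h : IsSimplex n s) :
    ∀ v ∈ s, v.length = n := by
  have hxi : ∀ n : ℕ, 2 ≤ n → (xi n).length = n := by
    intro n hn
    obtain ⟨m, rfl⟩ := Nat.exists_eq_add_of_le' (show 1 ≤ n by omega)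
    exact length_xi m
  have hins : ∀ (a b t : ℕ) (s : Finset (Br × Br)), (∀ v ∈ s.image Prod.fst, v.length = a) →
      (∀ v ∈ s.image Prod.snd, v.length = b) →
      ∀ v ∈ s.image fun x => ins t x.1 x.2, v.length = a + b - 1 := by
    intro a b t s h1 h2 v hv
    obtain ⟨x, hx, rfl⟩ := Finset.mem_image.1 hv
    have := length_ins t x.1 x.2
    rw [h1 _ (Finset.mem_image_of_mem _ hx), h2 _ (Finset.mem_image_of_mem _ hx)] at this
    omega
  induction h with
  | apex n hn =>
    intro v hv
    rw [Finset.mem_singleton.1 hv, hxi n hn]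
  | base a b t ha hb ht htb s hs hchain _ _ ih1 ih2 => exact hins a b t s ih1 ih2
  | cone a b t ha hb ht htb s hs hchain _ _ ih1 ih2 =>
    intro v hv
    rcases Finset.mem_insert.1 hv with rfl | hv
    · exact hxi _ (by omega)
    · exact hins a b t s ih1 ih2 v hv

/-! ### The cone operator and its compatibility with the triangulation -/

section Cone

variable {k : Type*} [Field k]

theorem C_le_wordChains (p n : ℕ) : C k p n ≤ wordChains k p n := by
  refine Finsupp.supported_mono ?_
  rintro σ ⟨h1, -, h3⟩
  exact ⟨h1, fun v hv => h3.length_eq v (List.mem_toFinset.2 hv)⟩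

/-- The cone operator with apex `c`, which vanishes on the vertex sequences starting at `c`. -/
noncomputable def coneAt (c : Br) : Chains k →ₗ[k] Chains k :=
  Finsupp.linearCombination k fun σ : List Br =>
    if σ.head? = some c then 0 else Finsupp.single (c :: σ) 1

theorem coneAt_single (c : Br) (σ : List Br) (r : k) :
    coneAt c (Finsupp.single σ r) =
      if σ.head? = some c then 0 else Finsupp.single (c :: σ) r := by
  simp only [coneAt, Finsupp.linearCombination_single]
  split_ifs <;> simp

theorem coneAt_pre_self (c : Br) (x : Chains k) : coneAt c (pre c x) = 0 := by
  induction x using Finsupp.induction_linear with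
  | zero => simp
  | add x y hx hy => simp only [map_add, hx, hy, add_zero]
  | single σ r => simp [coneAt_single]

theorem coneAt_pre_of_ne {c v : Br} (hv : v ≠ c) (x : Chains k) :
    coneAt c (pre v x) = pre c (pre v x) := by
  induction x using Finsupp.induction_linear with
  | zero => simp
  | add x y hx hy => simp only [map_add, hx, hy]
  | single σ r => simp [coneAt_single, hv]

theorem coneAt_eq_zero {c : Br} {x : Chains k}
    (hx : x ∈ Finsupp.supported k k {σ : List Br | σ.head? = some c}) : coneAt c x = 0 := by
  refine eq_of_eq_on_single _ 0 (fun σ hσ => ?_) hx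
  rw [coneAt_single, if_pos (show σ.head? = some c from hσ), LinearMap.zero_apply]

theorem coneAt_mem_head (c : Br) (x : Chains k) :
    coneAt c x ∈ Finsupp.supported k k {σ : List Br | σ.head? = some c} := by
  induction x using Finsupp.induction_linear with
  | zero => simp
  | add x y hx hy => rw [map_add]; exact add_mem hx hy
  | single σ r =>
    rw [coneAt_single]
    split_ifs
    · exact zero_mem _
    · exact Finsupp.single_mem_supported _ _ rfl

/-- The chains on `≺`-increasing sequences of words of length `n`. -/
noncomputable def orderedChains (k : Type*) [Field k] (p n : ℕ) : Submodule k (Chains k) :=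
  Finsupp.supported k k
    {σ : List Br | σ.length = p + 1 ∧ σ.Pairwise Prec ∧ ∀ v ∈ σ, v.length = n}

theorem orderedChains_le_wordChains (p n : ℕ) : orderedChains k p n ≤ wordChains k p n :=
  Finsupp.supported_mono fun _ h => ⟨h.1, h.2.2⟩

theorem coneAt_mem_wordChains {p n : ℕ} {x : Chains k} (hx : x ∈ wordChains k p (n + 1)) :
    coneAt (xi (n + 1)) x ∈ wordChains k (p + 1) (n + 1) := by
  have : wordChains k p (n + 1) ≤
      (wordChains k (p + 1) (n + 1)).comap (coneAt (xi (n + 1))) := by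
    rw [wordChains, Finsupp.supported_eq_span_single, Submodule.span_le]
    rintro _ ⟨σ, hσ, rfl⟩
    simp only [SetLike.mem_coe, Submodule.mem_comap]
    rw [coneAt_single]
    split_ifs
    · exact zero_mem _
    · refine Finsupp.single_mem_supported _ _ ⟨by rw [List.length_cons, hσ.1], fun v hv => ?_⟩
      rcases List.mem_cons.1 hv with rfl | hv
      · exact length_xi n
      · exact hσ.2 v hv
  exact this hx

/-- The cone operator with the minimal apex is a contracting homotopy in positive dimensions. -/
theorem dS_coneAt {p n : ℕ} {x : Chains k} (hx : x ∈ orderedChains k (p + 1) (n + 1)) :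
    dS k (coneAt (xi (n + 1)) x) = x - coneAt (xi (n + 1)) (dS k x) := by
  have hw := orderedChains_le_wordChains _ _ hx
  rw [dS_eq_bd (coneAt_mem_wordChains hw), dS_eq_bd hw]
  refine eq_of_eq_on_single (bd ∘ₗ coneAt (xi (n + 1)))
    (LinearMap.id - coneAt (xi (n + 1)) ∘ₗ bd) ?_ hx
  rintro σ ⟨h1, h2, h3⟩
  obtain ⟨v, w, ws, rfl⟩ : ∃ v w ws, σ = v :: w :: ws := by
    rcases σ with _ | ⟨v, _ | ⟨w, ws⟩⟩
    · simp at h1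
    · simp at h1
    · exact ⟨v, w, ws, rfl⟩
  have hvw : Prec v w := (List.pairwise_cons.1 h2).1 w (by simp)
  -- Only the first vertex can be the apex, so deleting it from a simplex that starts at the apex
  -- leaves a face whose cone restores the simplex.
  have hw' : w ≠ xi (n + 1) := by
    rintro rfl
    exact not_prec_xi (h3 v (by simp)) hvw
  have e1 : coneAt (xi (n + 1)) (Finsupp.single (w :: ws) (1 : k)) =
      Finsupp.single (xi (n + 1) :: w :: ws) 1 := by
    rw [coneAt_single, if_neg (by simpa using hw')]
  simp only [LinearMap.comp_apply, LinearMap.sub_apply, LinearMap.id_apply, bd_single, one_smul]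
  by_cases hv : v = xi (n + 1)
  · subst hv
    rw [coneAt_single, if_pos List.head?_cons, bdList, map_sub, coneAt_pre_self, e1]
    simp
  · rw [coneAt_single, if_neg (by simpa using hv), bd_single, one_smul, bdList]
    congr 1
    rw [bdList, map_sub, map_sub, coneAt_pre_of_ne hv, e1, pre_single]

/-- A staircase is a chain in the product order projecting onto both given simplices, which is
exactly what the constructor `cone` requires. -/
theorem isSimplex_cross {a b t : ℕ} (ha : 2 ≤ a) (hb : 2 ≤ b) (ht : 2 ≤ t) (htb : t ≤ b)
    {σ τ : List Br} (hσ : σ.Pairwise Prec) (hτ : τ.Pairwise Prec) (hσ' : IsSimplex a σ.toFinset)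
    (hτ' : IsSimplex b τ.toFinset) {l : List (Br × Br)} (hl0 : l ≠ [])
    (hl : l ∈ (crossG σ τ : List (Br × Br) →₀ k).support) :
    IsSimplex (a + b - 1)
      (insert (xi (a + b - 1)) (l.map fun x => ins t x.1 x.2).toFinset) := by
  obtain ⟨-, h2, h3, -⟩ := crossG_support _ _ l hl
  have h4 := crossG_pairwise _ _ _ _ hσ hτ l hl
  have e : (l.map fun x : Br × Br => ins t x.1 x.2).toFinset =
      l.toFinset.image fun x => ins t x.1 x.2 := by
    ext; simp
  have e1 : l.toFinset.image Prod.fst = σ.toFinset := by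
    ext v
    rw [List.mem_toFinset, ← h2]
    simp
  have e2 : l.toFinset.image Prod.snd = τ.toFinset := by
    ext v
    rw [List.mem_toFinset, ← h3]
    simp
  rw [e]
  refine .cone a b t ha hb ht htb l.toFinset (by simpa using hl0) ?_ (e1 ▸ hσ') (e2 ▸ hτ')
  have hle : ∀ u v : Br, u = v ∨ Prec u v → PrecEq u v := by
    rintro u v (rfl | h)
    · exact Relation.ReflTransGen.refl
    · exact h.to_reflTransGen
  have h5 : l.Pairwise fun x y => PrecEq x.1 y.1 ∧ PrecEq x.2 y.2 := h4.imp fun h => by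
    rcases h with ⟨h, h'⟩ | ⟨h, h'⟩
    · exact ⟨hle _ _ (Or.inr h), hle _ _ h'⟩
    · exact ⟨hle _ _ h', hle _ _ (Or.inr h)⟩
  intro x hx y hy hxy
  have : Std.Symm fun x y : Br × Br =>
    (PrecEq x.1 y.1 ∧ PrecEq x.2 y.2) ∨ (PrecEq y.1 x.1 ∧ PrecEq y.2 x.2) :=
    ⟨fun _ _ h => h.symm⟩
  exact List.Pairwise.forall_of_forall (R := fun x y : Br × Br =>
    (PrecEq x.1 y.1 ∧ PrecEq x.2 y.2) ∨ (PrecEq y.1 x.1 ∧ PrecEq y.2 x.2)) (fun x _ => Or.inl ⟨.refl, .refl⟩)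
    (h5.imp fun h => Or.inl h) (List.mem_toFinset.1 hx) (List.mem_toFinset.1 hy)

theorem map_ins_pairwise (t : ℕ) {σ τ : List Br} (hσ : σ.Pairwise Prec) (hτ : τ.Pairwise Prec)
    {l : List (Br × Br)} (hl : l ∈ (crossG σ τ : List (Br × Br) →₀ k).support) :
    (l.map fun x => ins t x.1 x.2).Pairwise Prec := by
  refine List.pairwise_map.2 ((crossG_pairwise _ _ _ _ hσ hτ l hl).imp ?_)
  rintro ⟨x1, x2⟩ ⟨y1, y2⟩ (⟨h, rfl | h'⟩ | ⟨h, rfl | h'⟩)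
  · exact h.ins_left t _
  · exact Relation.TransGen.trans (h.ins_left t x2) (h'.ins_right t y1)
  · exact h.ins_right t _
  · exact Relation.TransGen.trans (h'.ins_left t x2) (h.ins_right t y1)

theorem diamondAt_mem_supported {t : ℕ} {x y : Chains k} {S T U : Set (List Br)}
    (hx : x ∈ Finsupp.supported k k S) (hy : y ∈ Finsupp.supported k k T)
    (h : ∀ σ ∈ S, ∀ τ ∈ T, ∀ l ∈ (crossG σ τ : List (Br × Br) →₀ k).support,
      (l.map fun x => ins t x.1 x.2) ∈ U) :
    diamondAt k t x y ∈ Finsupp.supported k k U := by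
  rw [diamondAt_eq]
  exact push_mem_supported (S := {l : List (Br × Br) |
    (l.map fun x : Br × Br => ins t x.1 x.2) ∈ U})
    (crossL_mem_supported hx hy h) fun l hl => hl

theorem diamondAt_mem_orderedChains {p q a b : ℕ} (t : ℕ) {x y : Chains k} (hx : x ∈ C k p a)
    (hy : y ∈ C k q b) : diamondAt k t x y ∈ orderedChains k (p + q) (a + b - 1) := by
  have h1 := diamondAt_mem t (C_le_wordChains _ _ hx) (C_le_wordChains _ _ hy)
  have h2 : diamondAt k t x y ∈ Finsupp.supported k k {σ : List Br | σ.Pairwise Prec} :=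
    diamondAt_mem_supported hx hy fun σ hσ τ hτ l hl => map_ins_pairwise t hσ.2.1 hτ.2.1 hl
  exact fun σ hσ => ⟨(h1 hσ).1, h2 hσ, (h1 hσ).2⟩

/-- A simplex that does not start at the apex lies wholly above it by minimality, so prepending the
apex keeps the sequence increasing. -/
theorem coneAt_mem_C {p q a b t : ℕ} (ha : 2 ≤ a) (hb : 2 ≤ b) (ht : 2 ≤ t) (htb : t ≤ b)
    {x y : Chains k} (hx : x ∈ C k p a) (hy : y ∈ C k q b) :
    coneAt (xi (a + b - 1)) (diamondAt k t x y) ∈ C k (p + q + 1) (a + b - 1) := by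
  have h1 := diamondAt_mem_orderedChains t hx hy
  have h2 : diamondAt k t x y ∈ Finsupp.supported k k
      {σ : List Br | σ ≠ [] → IsSimplex (a + b - 1) (insert (xi (a + b - 1)) σ.toFinset)} :=
    diamondAt_mem_supported hx hy fun σ hσ τ hτ l hl hl0 =>
      isSimplex_cross ha hb ht htb hσ.2.1 hτ.2.1 hσ.2.2 hτ.2.2 (by simpa using hl0) hl
  have h3 : diamondAt k t x y ∈ Finsupp.supported k k
      {σ : List Br | (σ.length = p + q + 1 ∧ σ.Pairwise Prec ∧ ∀ v ∈ σ, v.length = a + b - 1) ∧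
        IsSimplex (a + b - 1) (insert (xi (a + b - 1)) σ.toFinset)} := by
    refine fun σ hσ => ⟨h1 hσ, h2 hσ ?_⟩
    rintro rfl
    simpa using (h1 hσ).1
  have : Finsupp.supported k k {σ : List Br | (σ.length = p + q + 1 ∧ σ.Pairwise Prec ∧
      ∀ v ∈ σ, v.length = a + b - 1) ∧
        IsSimplex (a + b - 1) (insert (xi (a + b - 1)) σ.toFinset)} ≤
      (C k (p + q + 1) (a + b - 1)).comap (coneAt (xi (a + b - 1))) := by
    rw [Finsupp.supported_eq_span_single, Submodule.span_le]
    rintro _ ⟨σ, ⟨⟨hl, hp, hn⟩, hs⟩, rfl⟩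
    simp only [SetLike.mem_coe, Submodule.mem_comap]
    rw [coneAt_single]
    split_ifs with hh
    · exact zero_mem _
    · refine Finsupp.single_mem_supported _ _ ⟨by rw [List.length_cons, hl], ?_, ?_⟩
      · rcases σ with _ | ⟨v, vs⟩
        · simp at hl
        have hv : Prec (xi (a + b - 1)) v :=
          xi_prec (hn v (by simp)) (by simpa using hh)
        refine List.pairwise_cons.2 ⟨fun w hw => ?_, hp⟩
        rcases List.mem_cons.1 hw with rfl | hw
        · exact hv
        · exact Relation.TransGen.trans hv ((List.pairwise_cons.1 hp).1 w hw)
      · rwa [List.toFinset_cons]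
  exact this h3

/-- A staircase starts at the pair of first vertices, and inserting a left comb at the first place
of a left comb gives a left comb. -/
theorem diamondAt_one_mem_head {a b : ℕ} {x y : Chains k}
    (hx : x ∈ Finsupp.supported k k {σ : List Br | σ.head? = some (xi (a + 1))})
    (hy : y ∈ Finsupp.supported k k {σ : List Br | σ.head? = some (xi (b + 1))}) :
    diamondAt k 1 x y ∈
      Finsupp.supported k k {σ : List Br | σ.head? = some (xi (a + b + 1))} := by
  refine diamondAt_mem_supported hx hy fun σ hσ τ hτ l hl => ?_
  obtain ⟨-, -, -, h4, h5⟩ := crossG_support _ _ l hl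
  simp only [Set.mem_ofPred_eq] at hσ hτ
  rw [hσ] at h4
  rw [hτ] at h5
  rcases l with _ | ⟨v, vs⟩
  · simp at h4
  · simp only [List.head?_cons, Option.map_some, Option.some.injEq] at h4 h5
    simp [h4, h5, ins_one_xi]

end Cone

/-! ### The recursive solution and the Maurer–Cartan equation -/

section Solution

variable (k : Type*) [Field k]

/-- The solution of the Maurer–Cartan equation, obtained by coning off the squares. -/
noncomputable def mcChain (n : ℕ) : Chains k :=
  if n = 0 then Finsupp.single [dot * dot] 1
  else - coneAt (xi (n + 2)) (∑ x ∈ (pairs n).attach,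
    preLie x.1.1 x.1.2 (mcChain x.1.1) (mcChain x.1.2))
  termination_by n
  decreasing_by all_goals have := mem_pairs.1 x.2; omega

theorem mcChain_zero : mcChain k 0 = Finsupp.single [dot * dot] 1 := by
  rw [mcChain, if_pos rfl]

theorem mcChain_succ (n : ℕ) :
    mcChain k (n + 1) = - coneAt (xi (n + 3)) (square (mcChain k) (n + 1)) := by
  rw [mcChain, if_neg (Nat.succ_ne_zero n), square,
    ← Finset.sum_attach (pairs (n + 1))]

variable {k}

theorem mcChain_mem_head (n : ℕ) :
    mcChain k n ∈ Finsupp.supported k k {σ : List Br | σ.head? = some (xi (n + 2))} := by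
  rcases n with _ | n
  · rw [mcChain_zero]
    exact Finsupp.single_mem_supported _ _ rfl
  · rw [mcChain_succ]
    exact neg_mem (coneAt_mem_head _ _)

theorem mcChain_mem (n : ℕ) : mcChain k n ∈ C k n (n + 2) := by
  induction n using Nat.strong_induction_on with
  | _ n ih =>
    rcases n with _ | n
    · rw [mcChain_zero]
      refine Finsupp.single_mem_supported _ _ ⟨rfl, List.pairwise_singleton _ _, ?_⟩
      exact IsSimplex.apex 2 le_rfl
    · rw [mcChain_succ]
      refine neg_mem ?_
      rw [square, map_sum]
      refine sum_mem fun x hx => ?_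
      rw [mem_pairs] at hx
      rw [preLie, map_sum]
      refine sum_mem fun t ht => ?_
      rw [Finset.mem_Icc] at ht
      rw [map_smul]
      refine Submodule.smul_mem _ _ ?_
      -- For `t = 1` every simplex already starts at the apex and its cone is zero; for `t ≥ 2` it
      -- lies on a base facet.
      rcases ht.1.eq_or_lt with rfl | h
      · have := diamondAt_one_mem_head (mcChain_mem_head (k := k) x.1) (mcChain_mem_head x.2)
        rw [show x.1 + 1 + (x.2 + 1) + 1 = n + 3 by omega] at this
        rw [coneAt_eq_zero this]
        exact zero_mem _
      · have := coneAt_mem_C (by omega) (by omega) h ht.2 (ih x.1 (by omega)) (ih x.2 (by omega))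
        rwa [show x.1 + 2 + (x.2 + 2) - 1 = n + 3 by omega,
          show x.1 + x.2 + 1 = n + 1 by omega] at this

/-- Ordered chains suffice for the homotopy formula, so the `t = 1` summands need no membership in
`C`. -/
theorem square_mem (n : ℕ) :
    square (mcChain k) (n + 1) ∈ orderedChains k n (n + 3) := by
  refine sum_mem fun x hx => sum_mem fun t _ => Submodule.smul_mem _ _ ?_
  rw [mem_pairs] at hx
  have := diamondAt_mem_orderedChains t (mcChain_mem (k := k) x.1) (mcChain_mem x.2)
  rwa [show x.1 + 2 + (x.2 + 2) - 1 = n + 3 by omega, show x.1 + x.2 = n by omega] at this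

theorem square_one : square (mcChain k) 1 =
    Finsupp.single [xi 3] 1 - Finsupp.single [dot * (dot * dot)] 1 := by
  have h : pairs 1 = {(0, 0)} := by decide
  rw [square, h, Finset.sum_singleton, preLie, show Finset.Icc 1 (0 + 2) = {1, 2} by decide,
    Finset.sum_pair (by decide), mcChain_zero]
  simp only [diamondAt_eq, crossL_single, crossG_cons_cons]
  simp only [and_self, if_true, crossG_nil_left, crossG_nil_right, map_zero, smul_zero, add_zero,
    mul_one, one_smul, push_single, List.map_cons, List.map_nil]
  norm_num
  rw [sub_eq_add_neg]
  rfl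

theorem dS_mcChain (n : ℕ) : dS k (mcChain k n) = - square (mcChain k) n := by
  induction n using Nat.strong_induction_on with
  | _ n ih =>
    rcases n with _ | _ | n
    · rw [dS_eq_zero (C_le_wordChains _ _ (mcChain_mem 0))]
      simp [square, pairs]
    -- The homotopy formula fails in dimension `0`. Here the cone kills the apex, and `e_1` is the
    -- edge from `ξ_3` to `•(••)`.
    · rw [mcChain_succ, square_one, map_sub, coneAt_single, coneAt_single,
        if_pos List.head?_cons, if_neg (by decide), zero_sub, neg_neg, dS_single]
      simp [bdList]
    · rw [mcChain_succ, map_neg, dS_coneAt (square_mem (n + 1)),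
        dS_square (fun i _ => C_le_wordChains _ _ (mcChain_mem i)) ih, map_zero, sub_zero]

end Solution

end Associahedron

theorem mainTheorem4 (k : Type*) [Field k] [CharZero k] :
    ∃ e : (n : ℕ) → Associahedron.C k n (n + 2),
      (e 0 : Associahedron.Chains k) =
          Finsupp.single [Associahedron.dot * Associahedron.dot] (1 : k) ∧
      ∀ n : ℕ,
        Associahedron.dS k (e n) +
          (2 : k)⁻¹ • ∑ ij ∈ (Finset.range n ×ˢ Finset.range n).filter
              (fun ij => ij.1 + ij.2 + 1 = n),
            Associahedron.bracket (e ij.1) (e ij.2) = 0 := by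
  open Associahedron in
  refine ⟨fun n => ⟨mcChain k n, mcChain_mem n⟩, mcChain_zero k, fun n => ?_⟩
  have h : ∑ ij ∈ pairs n, bracket (⟨mcChain k ij.1, mcChain_mem ij.1⟩ : C k ij.1 (ij.1 + 2))
      (⟨mcChain k ij.2, mcChain_mem ij.2⟩ : C k ij.2 (ij.2 + 2)) =
      (2 : k) • square (mcChain k) n := by
    have hb : ∀ i j : ℕ, bracket (⟨mcChain k i, mcChain_mem i⟩ : C k i (i + 2))
        (⟨mcChain k j, mcChain_mem j⟩ : C k j (j + 2)) =
        preLie i j (mcChain k i) (mcChain k j) + preLie j i (mcChain k j) (mcChain k i) := by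
      intro i j
      -- Both degrees are `1`, so the bracket is a sum; exchanging `i` and `j` shows that its two
      -- halves contribute equally.
      rw [bracket, show (((i + 2 : ℕ) : ℤ) - i - 1) * (((j + 2 : ℕ) : ℤ) - j - 1) = 1 by
        push_cast; ring, zpow_one, neg_one_smul, sub_neg_eq_add]
      rfl
    simp only [hb]
    rw [Finset.sum_add_distrib, two_smul]
    congr 1
    refine Finset.sum_nbij' Prod.swap Prod.swap ?_ ?_ (fun _ _ => rfl) (fun _ _ => rfl)
      (fun _ _ => rfl) <;>
    · intro x hx
      rw [mem_pairs] at hx ⊢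
      simp only [Prod.fst_swap, Prod.snd_swap]
      omega
  rw [pairs] at h
  simp only [h, dS_mcChain]
  rw [smul_smul, inv_mul_cancel₀ two_ne_zero, one_smul, neg_add_cancel]
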